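/- Let $m,n\ge 1$ be coprime integers and write $[m]=\{0,1,\dots,m-1\}$. An $(m,n)$-parking function is a word $\mathbf p=p_{n-1}\cdots p_1p_0\in[m]^n$ such that $\#\{j : p_j<i\}\ge \frac{in}{m}$ for all $1\le i\le m$. Let $W=\{x\in\mathbb R^m:\sum_i x_i=0\}$ and $V^m=\{x\in W : x_0\le x_1\le\dots\le x_{m-1}\}$. A letter $i\in[m]$ acts on $x\in V^m$ by adding $m$ to $x_i$, subtracting $1$ from every coordinate, and sorting the coordinates into weakly increasing order; a word acts letter by letter from right to left ($p_0$ first). An alcove is the closure of a connected component of the complement in $W$ of the hyperplanes $x_i-x_j=km$ ($0\le i<j\le m-1$, $k\in\mathbb Z$). The fundamental alcove is $A_0=\{x\in W: x_0\le x_1\le\dots\le x_{m-1}\le x_0+m\}$. The centroid of an alcove $A$ is the point $x$ in the interior of $A$ (relative to $W$) for which all the numbers $\frac{m+1}{2}-x_i$ are integers. Let $\mathbf p$ be an $(m,n)$-parking function. (1) $\mathbf p$ has a unique fixed point $x_{\mathbf p}\in V^m$, and $x_{\mathbf p}$ is the centroid of an alcove. The fundamental alcove has a unique centroid $x_0$,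 and there is $K$ such that $\mathbf p^k\cdot x_0=x_{\mathbf p}$ for all $k\ge K$. (2) Put $p(i)=p_{i \bmod n}$ for $i\ge 0$. The Gorsky–Mazin–Vazirani algorithm places the numbers $0,1,2,\dots$ one after another in positions $0,1,2,\dots$: when $0,\dots,\alpha-1$ have been placed, with $\beta$ in position $U^{-1}(\beta)$, the number $\alpha$ is placed in the leftmost empty position $i$ such that $i>U^{-1}(\alpha-m)$ (no condition if $\alpha<m$) and $p(i)=\#\{\beta\ge 0:\alpha-m<\beta<\alpha,\ U^{-1}(\beta)>i\}$. Let $U(i)$ be the number placed in position $i$, and $U(i)=\infty$ if there is none. Then every step can be carried out, $U(i)<\infty$ for every $i$, and there is $N$ such that $U(i+n)=U(i)+n$ for all $i>N$. The values $U(i)$, $i>N$, are those of an $m$-restricted affine permutation $u$ with $SP_u=\mathbf p$; that is, there is a bijection $u:\mathbb Z\to\mathbb Z$ such that $u(x+n)=u(x)+n$ for all $x$, $\sum_{k=0}^{n-1}u(k)=\frac{n(n-1)}2$, $u^{-1}(x)<u^{-1}(x+m)$ for all $x$, $u(i)=U(i)$ for all integers $i>N$, and $$SP_u(i):=\#\{j>i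 : 0<u(i)-u(j)<m\}=p_i\qquad(0\le i\le n-1).$$ (3) Let $S_0=\{0,1,\dots,m-1\}$ and, for $i\ge0$, let $V(i)=S_i[p(i)]$ and $S_{i+1}=(S_i\setminus\{V(i)\})\cup\{V(i)+m\}$, where $S[k]$ is the $k$-th smallest element of $S$, counted from $0$. Then there is $N$ such that $V(i+n)=V(i)+n$ for all $i>N$. -/

import Mathlib

open Topology

/-- The word `p = p_{n-1} ⋯ p_1 p_0` in the letters `{0, …, m-1}` (with `p_i` written `p i`) is an
`(m, n)`-parking function: `#{j : p_j < i} ≥ i n / m` for all `1 ≤ i ≤ m`. -/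
def IsParkingFunction {m n : ℕ} (p : Fin n → Fin m) : Prop :=
  ∀ i : ℕ, 1 ≤ i → i ≤ m →
    ((i : ℚ) * (n : ℚ)) / (m : ℚ) ≤ ((Finset.univ.filter fun j : Fin n => (p j : ℕ) < i).card : ℚ)

/-- The hyperplane `W` of points of `ℝ^m` whose coordinates sum to zero. -/
def sumZero (m : ℕ) : Set (Fin m → ℝ) := {x | ∑ i, x i = 0}

/-- The Weyl chamber `V^m`: coordinate sum zero and `x_0 ≤ x_1 ≤ ⋯ ≤ x_{m-1}`. -/
def weylChamber (m : ℕ) : Set (Fin m → ℝ) := {x | x ∈ sumZero m ∧ Monotone x}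

/-- The action of a letter `i`: add `m` to the `i`-th coordinate, subtract `1` from every
coordinate, and sort the coordinates into weakly increasing order. -/
noncomputable def letterAct {m : ℕ} (i : Fin m) (x : Fin m → ℝ) : Fin m → ℝ :=
  let y : Fin m → ℝ := fun j => (if j = i then x j + (m : ℝ) else x j) - 1
  y ∘ Tuple.sort y

/-- The action of the word `p_{n-1} ⋯ p_1 p_0`, one letter at a time from right to left, so that
`p_0` acts first. -/
noncomputable def wordAct {m n : ℕ} (p : Fin n → Fin m) (x : Fin m → ℝ) : Fin m → ℝ :=
  (List.ofFn p).foldl (fun y i => letterAct i y) x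

/-- The points of `W` that lie on no hyperplane `x_i - x_j = k m` (`i < j`, `k ∈ ℤ`) of the affine
braid arrangement (scaled by `m`). -/
def braidComplement (m : ℕ) : Set (Fin m → ℝ) :=
  {x | x ∈ sumZero m ∧ ∀ i j : Fin m, i < j → ∀ k : ℤ, x i - x j ≠ (k : ℝ) * (m : ℝ)}

/-- An alcove: the closure of a region, i.e. of a connected component of the complement in `W` of
the affine braid arrangement. -/
def IsAlcove (m : ℕ) (A : Set (Fin m → ℝ)) : Prop :=
  ∃ x ∈ braidComplement m, A = closure (connectedComponentIn (braidComplement m) x)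

/-- The fundamental alcove `x_0 ≤ x_1 ≤ ⋯ ≤ x_{m-1} ≤ x_0 + m` inside `W`. -/
def fundamentalAlcove (m : ℕ) [NeZero m] : Set (Fin m → ℝ) :=
  {x | x ∈ sumZero m ∧ Monotone x ∧ ∀ i, x i ≤ x 0 + (m : ℝ)}

/-- `x` is the centroid of the alcove `A`: it lies in the interior of `A` relative to `W`, and all
the numbers `(m+1)/2 - x_i` are integers. -/
def IsAlcoveCentroid {m : ℕ} (A : Set (Fin m → ℝ)) (x : Fin m → ℝ) : Prop :=
  x ∈ sumZero m ∧ A ∈ 𝓝[sumZero m] x ∧ ∀ i, ∃ z : ℤ, ((m : ℝ) + 1) / 2 - x i = (z : ℝ)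

/-- The periodic extension `p(i + k n) = p(i)` of a word, on the nonnegative integers. -/
def periodicExt {m n : ℕ} [NeZero n] (p : Fin n → Fin m) (i : ℕ) : ℕ :=
  (p ⟨i % n, Nat.mod_lt i (NeZero.pos n)⟩ : ℕ)

/-- The positions in which the number `α` may be placed, where `T β` is the position of each
already placed number `β < α`: position `i` is still empty, it is to the right of the position of
`α - m` (no condition when `α < m`), and `q(i) = #{β : α - m < β < α, T β > i}`. -/
def gmvAllowed (m : ℕ) (q : ℕ → ℕ) (α : ℕ) (T : Fin α → ℕ) : Set ℕ :=
  {i | (∀ β : Fin α, T β ≠ i) ∧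
       (∀ β : Fin α, (β : ℕ) + m = α → T β < i) ∧
       q i = (Finset.univ.filter fun β : Fin α => α < (β : ℕ) + m ∧ i < T β).card}

/-- The position in which the Gorsky–Mazin–Vazirani algorithm places `α`: the leftmost allowed
one, after `0, 1, …, α - 1` have been placed. -/
noncomputable def gmvPos (m : ℕ) (q : ℕ → ℕ) (α : ℕ) : ℕ :=
  sInf (gmvAllowed m q α fun β : Fin α => gmvPos m q (β : ℕ))
termination_by α
decreasing_by exact β.isLt

/-- The function `U` produced by the Gorsky–Mazin–Vazirani algorithm: `U(i)` is the number placed in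
position `i`, and `U(i) = ∞` if no number is ever placed there. -/
noncomputable def gmvU (m : ℕ) (q : ℕ → ℕ) (i : ℕ) : ℕ∞ :=
  sInf {a : ℕ∞ | ∃ α : ℕ, gmvPos m q α = i ∧ a = (α : ℕ∞)}

/-- The sets `S_i` of the second algorithm: `S_0 = {0, …, m-1}`, and `S_{i+1}` arises from `S_i` by
replacing `α = S_i[q(i)]` by `α + m`. Here `S[k] = Nat.nth (· ∈ S) k` is the `k`-th smallest element
of `S`, counted from `0`. -/
noncomputable def mtwSet (m : ℕ) (q : ℕ → ℕ) : ℕ → Finset ℕ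
  | 0 => Finset.range m
  | i + 1 =>
    insert (Nat.nth (fun s => s ∈ mtwSet m q i) (q i) + m)
      ((mtwSet m q i).erase (Nat.nth (fun s => s ∈ mtwSet m q i) (q i)))

/-- The function `V(i) = S_i[q(i)]` produced by the second algorithm. -/
noncomputable def mtwV (m : ℕ) (q : ℕ → ℕ) (i : ℕ) : ℕ :=
  Nat.nth (fun s => s ∈ mtwSet m q i) (q i)

/-- The affine symmetric group: bijections `u : ℤ → ℤ` with `u(x + n) = u(x) + n` and
`u(0) + ⋯ + u(n-1) = n(n-1)/2`. -/
def IsAffinePerm (n : ℕ) (u : Equiv.Perm ℤ) : Prop :=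
  (∀ x : ℤ, u (x + (n : ℤ)) = u x + (n : ℤ)) ∧
    ∑ k ∈ Finset.range n, u (k : ℤ) = ∑ k ∈ Finset.range n, (k : ℤ)

/-- The `m`-restricted affine permutations: `u⁻¹(x) < u⁻¹(x + m)` for all `x`. -/
def IsRestrictedAffinePerm (m n : ℕ) (u : Equiv.Perm ℤ) : Prop :=
  IsAffinePerm n u ∧ ∀ x : ℤ, u.symm x < u.symm (x + (m : ℤ))

/-- The Pak–Stanley-type map `SP_u(i) = #{j > i : 0 < u(i) - u(j) < m}`. -/
noncomputable def pakStanley (m : ℕ) (u : Equiv.Perm ℤ) (i : ℤ) : ℕ :=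
  Set.ncard {j : ℤ | i < j ∧ 0 < u i - u j ∧ u i - u j < (m : ℤ)}

/-!
Write `T` for the action of the parking function `p`, a word of length `n`.

**Rigidity.** A letter translates a point and sorts its coordinates, and sorting does not increase
Euclidean distances; by the equality case of the rearrangement inequality, the distance of points
with distinct coordinates is kept only if one permutation sorts both points
(`monotone_comp_sort_of_sqDist_eq`). Let a finite family of
centroids of alcoves be permuted by `T`. All distances in it are kept, so `T` moves all its members
by the same permutation `σ` of the coordinates, up to multiples of `m` that are the same for all
members, and up to a translation by `n`. Averaging over the family shows that `σ` shifts residues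
modulo `m` by `n`, hence is an `m`-cycle (`bijective_pow_apply_of_relation`). The ranks of two
coordinates have equal sums along an `m`-cycle, so their order is reversed at some time, by a single
step of size `m` across `0`. Therefore the difference of these coordinates lies in the same interval
`(k m, (k + 1) m)` for all members, all members lie in one alcove, and the family is a single point
(`eq_of_permuted_family`).

**Existence and uniqueness of the fixed point.** The same relation of period `n` shows that every
fixed point of `T` in the chamber is the centroid of an alcove (`isLatticePoint_of_run_eq`), so
rigidity gives uniqueness. For existence, the parking condition says that the `i` smallest
coordinates do not drift to `-∞`: a lower bound for the sums over `i` coordinates that is strongly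
concave in `i` is preserved by `T` (`le_sum_run`). Hence the orbit of a centroid is bounded, so it
ends in a cycle, which by rigidity is a fixed point (`IsParkingFunction.exists_isFixedPt_iterate`).

**The two algorithms.** The sets `S_t` of the second algorithm are translates of the orbit of the
centroid of the fundamental alcove (`exists_enum_mtwSet`), so the values `V(t)` become affine
periodic. As `S_t` consists of the first unused elements of the residue classes modulo `m`, the map
`V` is a bijection of `ℕ`, and `p(t)` counts the numbers in the window of length `m` below `V(t)`
that are used after time `t` (`count_mtwSet`). Consequently the Gorsky–Mazin–Vazirani algorithm
places `α` in position `V⁻¹(α)` (`isLeast_gmvAllowed`), that is, `U = V`. The periodic part of `V`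
extends to a bijection of `ℤ`; it has the normalization of an affine permutation because a bijection
of `ℕ` with bounded displacement has no drift (`abs_sum_sub_le`).
-/

variable {m : ℕ}

/-- The vector obtained from `x` by the letter `i` before the coordinates are sorted. -/
def letterShift (i : Fin m) (x : Fin m → ℝ) : Fin m → ℝ :=
  fun j => (if j = i then x j + (m : ℝ) else x j) - 1

theorem letterAct_eq_comp_sort (i : Fin m) (x : Fin m → ℝ) :
    letterAct i x = letterShift i x ∘ Tuple.sort (letterShift i x) := rfl

/-- The configuration reached from `x` when the letters `q 0, …, q (t - 1)` act one after another. -/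
noncomputable def run (q : ℕ → Fin m) (x : Fin m → ℝ) : ℕ → Fin m → ℝ
  | 0 => x
  | t + 1 => letterAct (q t) (run q x t)

theorem run_add (q : ℕ → Fin m) (x : Fin m → ℝ) (a b : ℕ) :
    run q x (a + b) = run (fun t => q (a + t)) (run q x a) b := by
  induction b with
  | zero => rfl
  | succ b ih => rw [← add_assoc]; simp only [run, ih]

theorem foldl_ofFn_eq_run {n : ℕ} (p : Fin n → Fin m) (q : ℕ → Fin m)
    (h : ∀ i : Fin n, q i = p i) (x : Fin m → ℝ) :
    wordAct p x = run q x n := by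
  unfold wordAct
  induction n with
  | zero => simp [run]
  | succ n ih =>
    rw [List.ofFn_succ_last, List.foldl_append, ih (fun i => p i.castSucc) (fun i => h i.castSucc)]
    simp [run, ← h (Fin.last n)]

/-! ### Sorting does not increase distances -/

/-- The squared Euclidean distance on `ℝ^m`. -/
def sqDist (x y : Fin m → ℝ) : ℝ := ∑ i, (x i - y i) ^ 2

theorem sqDist_letterShift (i : Fin m) (x y : Fin m → ℝ) :
    sqDist (letterShift i x) (letterShift i y) = sqDist x y := by
  unfold sqDist letterShift
  refine Finset.sum_congr rfl fun j _ => ?_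
  split_ifs <;> ring

theorem sqDist_eq_comp_perm (a b : Fin m → ℝ) (τ : Equiv.Perm (Fin m)) :
    sqDist a b = ∑ j, a j ^ 2 + ∑ j, b j ^ 2 - 2 * ∑ j, a (τ j) * b (τ j) := by
  rw [Equiv.sum_comp τ (fun j => a j * b j), Finset.mul_sum, ← Finset.sum_add_distrib,
    ← Finset.sum_sub_distrib]
  exact Finset.sum_congr rfl fun j _ => by ring

theorem sqDist_sort (a b : Fin m → ℝ) :
    sqDist (a ∘ Tuple.sort a) (b ∘ Tuple.sort b) = ∑ j, a j ^ 2 + ∑ j, b j ^ 2 -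
      2 * ∑ j, (a ∘ Tuple.sort a) j * (b ∘ Tuple.sort b) j := by
  rw [sqDist_eq_comp_perm _ _ 1, ← Equiv.sum_comp (Tuple.sort a) (fun j => a j ^ 2),
    ← Equiv.sum_comp (Tuple.sort b) (fun j => b j ^ 2)]
  rfl

theorem sqDist_sort_le (a b : Fin m → ℝ) :
    sqDist (a ∘ Tuple.sort a) (b ∘ Tuple.sort b) ≤ sqDist a b := by
  rw [sqDist_sort, sqDist_eq_comp_perm a b (Tuple.sort a)]
  have := ((Tuple.monotone_sort a).monovary (Tuple.monotone_sort b)).sum_mul_comp_perm_le_sum_mul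
    (σ := (Tuple.sort a).trans (Tuple.sort b).symm)
  simp only [Function.comp_apply, Equiv.trans_apply, Equiv.apply_symm_apply] at this ⊢
  linarith

/-- The equality case of the rearrangement inequality: if sorting does not bring `a` and `b` closer
to each other, the permutation that sorts `a` sorts `b` too. -/
theorem monotone_comp_sort_of_sqDist_eq (a b : Fin m → ℝ) (ha : StrictMono (a ∘ Tuple.sort a))
    (h : sqDist (a ∘ Tuple.sort a) (b ∘ Tuple.sort b) = sqDist a b) :
    Monotone (b ∘ Tuple.sort a) := by
  rw [sqDist_sort, sqDist_eq_comp_perm a b (Tuple.sort a)] at h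
  have key := ((Tuple.monotone_sort a).monovary
    (Tuple.monotone_sort b)).sum_mul_comp_perm_eq_sum_mul_iff
    (σ := (Tuple.sort a).trans (Tuple.sort b).symm)
  simp only [Function.comp_apply, Equiv.trans_apply, Equiv.apply_symm_apply] at key h
  have mv := key.1 (by linarith)
  intro i j hij
  rcases hij.eq_or_lt with rfl | hij
  · exact le_rfl
  by_contra hlt
  push Not at hlt
  have h2 := @mv j i (by simpa using hlt)
  exact absurd (ha hij) (not_lt.2 h2)

theorem sqDist_letterAct_le (i : Fin m) (x y : Fin m → ℝ) :
    sqDist (letterAct i x) (letterAct i y) ≤ sqDist x y := by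
  rw [← sqDist_letterShift i x y, letterAct_eq_comp_sort, letterAct_eq_comp_sort]
  exact sqDist_sort_le _ _

theorem antitone_sqDist_run (q : ℕ → Fin m) (x y : Fin m → ℝ) :
    Antitone fun t => sqDist (run q x t) (run q y t) :=
  antitone_nat_of_succ_le fun _ => sqDist_letterAct_le _ _ _

/-! ### Lattice configurations -/

/-- The sorted points of `W` that lie in the coset of the integer lattice containing the centroids
of alcoves, and on no hyperplane of the affine braid arrangement: the centroids of the alcoves in
the Weyl chamber. -/
structure IsLatticePoint (x : Fin m → ℝ) : Prop where
  mono : Monotone x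
  sum_eq : ∑ i, x i = 0
  integral : ∀ i, ∃ z : ℤ, ((m : ℝ) + 1) / 2 - x i = (z : ℝ)
  ne_mul : ∀ i j, i ≠ j → ∀ k : ℤ, x i - x j ≠ (k : ℝ) * (m : ℝ)

theorem IsLatticePoint.strictMono {x : Fin m → ℝ} (hx : IsLatticePoint x) : StrictMono x :=
  hx.mono.strictMono_of_injective fun i j h => by
    by_contra hij
    exact hx.ne_mul i j hij 0 (by simp [h])

theorem letterShift_eq (i : Fin m) (x : Fin m → ℝ) (j : Fin m) :
    letterShift i x j = x j + (m : ℝ) * ((if j = i then 1 else 0 : ℤ) : ℝ) - 1 := by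
  unfold letterShift
  split_ifs <;> simp

theorem sum_letterAct (i : Fin m) (x : Fin m → ℝ) : ∑ j, letterAct i x j = ∑ j, x j := by
  rw [letterAct_eq_comp_sort]
  simp only [Function.comp_apply]
  rw [Equiv.sum_comp (Tuple.sort (letterShift i x)) (letterShift i x)]
  simp [letterShift_eq, Finset.sum_sub_distrib, Finset.sum_add_distrib]

theorem monotone_letterAct (i : Fin m) (x : Fin m → ℝ) : Monotone (letterAct i x) := by
  rw [letterAct_eq_comp_sort]
  exact Tuple.monotone_sort _

theorem IsLatticePoint.letterAct {x : Fin m → ℝ} (hx : IsLatticePoint x) (i : Fin m) :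
    IsLatticePoint (letterAct i x) where
  mono := monotone_letterAct i x
  sum_eq := by rw [sum_letterAct, hx.sum_eq]
  integral j := by
    simp only [letterAct_eq_comp_sort, Function.comp_apply]
    generalize Tuple.sort (letterShift i x) j = j'
    obtain ⟨z, hz⟩ := hx.integral j'
    refine ⟨z - m * (if j' = i then 1 else 0 : ℤ) + 1, ?_⟩
    rw [letterShift_eq]
    push_cast
    linarith
  ne_mul a b hab k h := by
    simp only [letterAct_eq_comp_sort, Function.comp_apply, letterShift_eq] at h
    have hab' := (Tuple.sort (letterShift i x)).injective.ne hab
    generalize Tuple.sort (letterShift i x) a = a' at *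
    generalize Tuple.sort (letterShift i x) b = b' at *
    refine hx.ne_mul a' b' hab' (k - (if a' = i then 1 else 0 : ℤ) + (if b' = i then 1 else 0 : ℤ)) ?_
    push_cast
    push_cast at h
    linarith

theorem IsLatticePoint.run {x : Fin m → ℝ} (hx : IsLatticePoint x) (q : ℕ → Fin m) (t : ℕ) :
    IsLatticePoint (run q x t) := by
  induction t with
  | zero => exact hx
  | succ t ih => exact ih.letterAct _

theorem exists_perm_run (q : ℕ → Fin m) (x : Fin m → ℝ) (t : ℕ) :
    ∃ (σ : Equiv.Perm (Fin m)) (c : Fin m → ℤ),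
      ∀ i, run q x t i = x (σ i) + (m : ℝ) * (c i : ℝ) - (t : ℝ) := by
  induction t with
  | zero => exact ⟨1, 0, fun i => by simp [run]⟩
  | succ t ih =>
    obtain ⟨σ, c, h⟩ := ih
    set τ := Tuple.sort (letterShift (q t) (run q x t)) with hτ
    refine ⟨σ * τ, fun i => c (τ i) + if τ i = q t then 1 else 0, fun i => ?_⟩
    simp only [run, letterAct_eq_comp_sort, Function.comp_apply, ← hτ]
    rw [letterShift_eq, h, Equiv.Perm.mul_apply]
    push_cast
    ring

/-! ### Coprimality makes the permutation of the coordinates a single cycle -/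

theorem apply_pow_of_relation {n : ℕ} {σ : Equiv.Perm (Fin m)} {c : Fin m → ℤ} {Y : Fin m → ℝ}
    (h : ∀ i, Y i = Y (σ i) + (m : ℝ) * (c i : ℝ) - (n : ℝ)) (i : Fin m) (k : ℕ) :
    ∃ e : ℤ, Y ((σ ^ k) i) = Y i + (k : ℝ) * (n : ℝ) - (m : ℝ) * (e : ℝ) := by
  induction k with
  | zero => exact ⟨0, by simp⟩
  | succ k ih =>
    obtain ⟨e, he⟩ := ih
    refine ⟨e + c ((σ ^ k) i), ?_⟩
    have := h ((σ ^ k) i)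
    rw [pow_succ', Equiv.Perm.mul_apply]
    rw [Int.cast_add, Nat.cast_succ]
    linarith

theorem eq_of_dvd_sub_mul {n : ℕ} (hmn : Nat.Coprime m n) {k l : Fin m} {e : ℤ}
    (h : ((k : ℕ) : ℝ) * (n : ℝ) - ((l : ℕ) : ℝ) * (n : ℝ) = (m : ℝ) * (e : ℝ)) : k = l := by
  have h' : (((k : ℕ) : ℤ) - ((l : ℕ) : ℤ)) * (n : ℤ) = (m : ℤ) * e := by
    have : ((((k : ℕ) : ℤ) - ((l : ℕ) : ℤ)) * (n : ℤ) : ℝ) = ((m : ℤ) * e : ℝ) := by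
      push_cast; linarith
    exact_mod_cast this
  have hd : (m : ℤ) ∣ ((k : ℕ) : ℤ) - ((l : ℕ) : ℤ) :=
    (Nat.isCoprime_iff_coprime.2 hmn).dvd_of_dvd_mul_right ⟨e, h'⟩
  have hk := k.2
  have hl := l.2
  have h0 := Int.eq_zero_of_abs_lt_dvd hd (by rw [abs_lt]; constructor <;> omega)
  exact Fin.ext (by omega)

/-- A permutation that translates `Y` by `n` modulo `m` is an `m`-cycle: going once around a cycle
of length `ℓ` shows that `m` divides `ℓ n`. -/
theorem bijective_pow_apply_of_relation {n : ℕ} (hmn : Nat.Coprime m n) {σ : Equiv.Perm (Fin m)}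
    {c : Fin m → ℤ} {Y : Fin m → ℝ}
    (h : ∀ i, Y i = Y (σ i) + (m : ℝ) * (c i : ℝ) - (n : ℝ)) (i : Fin m) :
    Function.Bijective fun k : Fin m => (σ ^ (k : ℕ)) i := by
  refine Finite.injective_iff_bijective.1 fun k l hkl => ?_
  obtain ⟨e, he⟩ := apply_pow_of_relation h i k
  obtain ⟨f, hf⟩ := apply_pow_of_relation h i l
  change (σ ^ (k : ℕ)) i = (σ ^ (l : ℕ)) i at hkl
  rw [hkl, hf] at he
  refine eq_of_dvd_sub_mul hmn (e := e - f) ?_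
  push_cast
  linarith

/-- A fixed point of a word of length `n` coprime to `m` is a lattice point. -/
theorem isLatticePoint_of_run_eq {n : ℕ} [NeZero m] (hmn : Nat.Coprime m n) (q : ℕ → Fin m)
    {x : Fin m → ℝ} (hmono : Monotone x) (hsum : ∑ i, x i = 0) (hx : run q x n = x) :
    IsLatticePoint x := by
  obtain ⟨σ, c, h⟩ := exists_perm_run q x n
  rw [hx] at h
  have hbij := bijective_pow_apply_of_relation hmn h
  refine ⟨hmono, hsum, fun i => ?_, fun a b hab k hk => ?_⟩
  · choose e he using apply_pow_of_relation h i
    have hs : ∑ k : Fin m, x ((σ ^ (k : ℕ)) i) = 0 := by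
      rw [(hbij i).sum_comp x, hsum]
    simp only [he, Finset.sum_sub_distrib, Finset.sum_add_distrib, ← Finset.mul_sum,
      ← Finset.sum_mul] at hs
    have hg : ∑ k : Fin m, ((k : ℕ) : ℝ) = (m : ℝ) * ((m : ℝ) - 1) / 2 := by
      rw [Fin.sum_univ_eq_sum_range (fun k => (k : ℝ)) m]
      have := Finset.sum_range_id_mul_two m
      have h1 : 1 ≤ m := NeZero.one_le
      have h2 : ((∑ k ∈ Finset.range m, (k : ℝ)) * 2) = m * ((m : ℝ) - 1) := by
        have := congrArg (Nat.cast (R := ℝ)) this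
        push_cast [Nat.cast_sub h1] at this
        exact this
      linarith
    rw [hg] at hs
    simp only [Finset.sum_const, Finset.card_univ, Fintype.card_fin, nsmul_eq_mul] at hs
    have hm0 : (m : ℝ) ≠ 0 := NeZero.ne _
    have hxi : x i = (∑ k : Fin m, (e k : ℝ)) - (m - 1) / 2 * n := by
      have : (m : ℝ) * x i = m * ((∑ k : Fin m, (e k : ℝ)) - (m - 1) / 2 * n) := by linarith
      exact mul_left_cancel₀ hm0 this
    -- `(m + 1) + (m - 1) n` is even, because `m` and `n` are not both even
    obtain ⟨r, hr⟩ : Even (((m : ℤ) + 1) + (m - 1) * n) := by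
      rcases Nat.even_or_odd m with hm | hm
      · have hn : Odd n := by
          rw [← Nat.not_even_iff_odd]
          intro hn
          have := Nat.dvd_gcd hm.two_dvd hn.two_dvd
          rw [hmn] at this
          omega
        have hm' : Even (m : ℤ) := by exact_mod_cast hm
        have hn' : Odd (n : ℤ) := by exact_mod_cast hn
        exact (hm'.add_one).add_odd ((hm'.sub_odd odd_one).mul hn')
      · have hm' : Odd (m : ℤ) := by exact_mod_cast hm
        exact (hm'.add_odd odd_one).add ((hm'.sub_odd odd_one).mul_right _)
    refine ⟨r - ∑ k : Fin m, e k, ?_⟩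
    have hr' : ((m : ℝ) + 1) + (m - 1) * n = r + r := by exact_mod_cast hr
    push_cast
    rw [hxi]
    linarith
  · obtain ⟨k', hk'⟩ := (hbij a).2 a
    obtain ⟨l', hl'⟩ := (hbij a).2 b
    obtain ⟨e, he⟩ := apply_pow_of_relation h a k'
    obtain ⟨f, hf⟩ := apply_pow_of_relation h a l'
    change (σ ^ (k' : ℕ)) a = a at hk'
    change (σ ^ (l' : ℕ)) a = b at hl'
    apply hab
    rw [← hk', ← hl', he, hf] at hk
    rw [← hk', ← hl', eq_of_dvd_sub_mul hmn (k := k') (l := l') (e := k + e - f)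
      (by push_cast; linarith)]

/-! ### Rigidity of families of lattice points permuted by a word -/

/-- All configurations of the family `y` lie strictly between the same two consecutive hyperplanes
`x_i - x_j = q m` and `x_i - x_j = (q + 1) m`. -/
def SameStrip {ι : Type*} (y : ι → Fin m → ℝ) (i j : Fin m) : Prop :=
  ∃ q : ℤ, ∀ k, (q : ℝ) * m < y k i - y k j ∧ y k i - y k j < ((q : ℝ) + 1) * m

theorem SameStrip.of_relation {ι : Type*} {y y' : ι → Fin m → ℝ} {i j i' j' : Fin m} (d : ℤ)
    (h : ∀ k, y' k i' - y' k j' = y k i - y k j + (m : ℝ) * (d : ℝ)) (hs : SameStrip y i j) :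
    SameStrip y' i' j' := by
  obtain ⟨q, hq⟩ := hs
  refine ⟨q + d, fun k => ?_⟩
  rw [h]
  obtain ⟨h1, h2⟩ := hq k
  push_cast
  constructor <;> linarith

theorem sqDist_run_eq_of_le {q : ℕ → Fin m} {x y : Fin m → ℝ} {n : ℕ}
    (h : sqDist (run q x n) (run q y n) = sqDist x y) {t : ℕ} (ht : t ≤ n) :
    sqDist (run q x t) (run q y t) = sqDist x y :=
  le_antisymm (antitone_sqDist_run q x y (Nat.zero_le t))
    (h ▸ antitone_sqDist_run q x y ht)

/-- If the distances within a family of lattice points stay the same, a letter moves and sorts all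
members in the same way. A pair of coordinates whose order is reversed by the letter lies in a
common strip, because its difference jumps over `0` by one step of size `m`. -/
theorem exists_common_perm_letterAct {ι : Type*} {y : ι → Fin m → ℝ}
    (hy : ∀ k, IsLatticePoint (y k)) (a : Fin m)
    (hd : ∀ k l, sqDist (letterAct a (y k)) (letterAct a (y l)) = sqDist (y k) (y l)) :
    ∃ τ : Equiv.Perm (Fin m),
      (∀ k i, letterAct a (y k) i
        = y k (τ i) + (m : ℝ) * ((if τ i = a then 1 else 0 : ℤ) : ℝ) - 1) ∧
      ∀ i j, (i < j ↔ τ i < τ j) ∨ SameStrip y (τ i) (τ j) := by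
  rcases isEmpty_or_nonempty ι with hι | ⟨⟨k₀⟩⟩
  · exact ⟨1, fun k => hι.elim k, fun i j => Or.inl Iff.rfl⟩
  set τ := Tuple.sort (letterShift a (y k₀)) with hτ
  have hact : ∀ k, letterAct a (y k) = letterShift a (y k) ∘ τ := by
    intro k
    have hmono : Monotone (letterShift a (y k) ∘ τ) := by
      refine monotone_comp_sort_of_sqDist_eq _ _ ?_ ?_
      · exact ((hy k₀).letterAct a).strictMono
      · rw [sqDist_letterShift]
        exact hd k₀ k
    rw [letterAct_eq_comp_sort]
    exact (Tuple.comp_sort_eq_comp_iff_monotone.2 hmono).symm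
  have hact' : ∀ k i, letterAct a (y k) i
        = y k (τ i) + (m : ℝ) * ((if τ i = a then 1 else 0 : ℤ) : ℝ) - 1 := by
    intro k i
    rw [hact, Function.comp_apply, letterShift_eq]
  refine ⟨τ, hact', fun i j => ?_⟩
  have hm : (0 : ℝ) ≤ m := Nat.cast_nonneg m
  rcases lt_trichotomy i j with hij | rfl | hij
  · rcases lt_or_ge (τ i) (τ j) with h | h
    · exact Or.inl ⟨fun _ => h, fun _ => hij⟩
    · right
      have hne : τ j < τ i := lt_of_le_of_ne h (τ.injective.ne hij.ne')
      refine ⟨0, fun k => ?_⟩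
      have h1 := (hy k).strictMono hne
      have h2 := ((hy k).letterAct a).strictMono hij
      rw [hact', hact'] at h2
      split_ifs at h2 <;> norm_num at h2 ⊢ <;> constructor <;> linarith
  · exact Or.inl (by simp)
  · rcases lt_or_ge (τ i) (τ j) with h | h
    · right
      refine ⟨-1, fun k => ?_⟩
      have h1 := (hy k).strictMono h
      have h2 := ((hy k).letterAct a).strictMono hij
      rw [hact', hact'] at h2
      split_ifs at h2 <;> norm_num at h2 ⊢ <;> constructor <;> linarith
    · exact Or.inl ⟨fun h' => absurd h' hij.asymm, fun h' => absurd h' h.not_gt⟩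

theorem exists_common_perm_run {ι : Type*} {y : ι → Fin m → ℝ}
    (hy : ∀ k, IsLatticePoint (y k)) (q : ℕ → Fin m) (t : ℕ)
    (hd : ∀ k l, sqDist (run q (y k) t) (run q (y l) t) = sqDist (y k) (y l)) :
    ∃ (σ : Equiv.Perm (Fin m)) (c : Fin m → ℤ),
      (∀ k i, run q (y k) t i = y k (σ i) + (m : ℝ) * (c i : ℝ) - (t : ℝ)) ∧
      ∀ i j, (i < j ↔ σ i < σ j) ∨ SameStrip y (σ i) (σ j) := by
  induction t with
  | zero => exact ⟨1, 0, fun k i => by simp [run], fun i j => Or.inl Iff.rfl⟩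
  | succ t ih =>
    have hd' : ∀ k l, sqDist (run q (y k) t) (run q (y l) t) = sqDist (y k) (y l) :=
      fun k l => sqDist_run_eq_of_le (hd k l) t.le_succ
    obtain ⟨σ, c, h, hord⟩ := ih hd'
    obtain ⟨τ, h', hord'⟩ := exists_common_perm_letterAct (fun k => (hy k).run q t) (q t)
      (fun k l => (hd k l).trans (hd' k l).symm)
    refine ⟨σ * τ, fun i => c (τ i) + if τ i = q t then 1 else 0, fun k i => ?_, fun i j => ?_⟩
    · simp only [run]
      rw [h', h, Equiv.Perm.mul_apply]
      push_cast
      ring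
    · rw [Equiv.Perm.mul_apply, Equiv.Perm.mul_apply]
      rcases hord (τ i) (τ j) with h1 | h1
      · rcases hord' i j with h2 | h2
        · exact Or.inl (h2.trans h1)
        · refine Or.inr (h2.of_relation (c (τ j) - c (τ i)) fun k => ?_)
          rw [h, h]
          push_cast
          ring
      · exact Or.inr h1

/-- The residues modulo `m` of the coordinates of a lattice point are all different, so each
coordinate is determined by the strips that contain the differences of the coordinates. -/
theorem IsLatticePoint.eq_of_sameStrip {x y : Fin m → ℝ} (hx : IsLatticePoint x)
    (hy : IsLatticePoint y)
    (h : ∀ i j, i ≠ j → ∃ q : ℤ, ((q : ℝ) * m < x i - x j ∧ x i - x j < ((q : ℝ) + 1) * m) ∧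
      ((q : ℝ) * m < y i - y j ∧ y i - y j < ((q : ℝ) + 1) * m)) : x = y := by
  funext i
  have hm : 0 < m := i.pos
  have : NeZero m := ⟨hm.ne'⟩
  have hstrip : ∀ j, ∃ q : ℤ, ((q : ℝ) * m ≤ x i - x j ∧ x i - x j < ((q : ℝ) + 1) * m) ∧
      ((q : ℝ) * m ≤ y i - y j ∧ y i - y j < ((q : ℝ) + 1) * m) := by
    intro j
    rcases eq_or_ne i j with rfl | hij
    · exact ⟨0, by simp [hm]⟩
    · obtain ⟨q, h1, h2⟩ := h i j hij
      exact ⟨q, ⟨h1.1.le, h1.2⟩, h2.1.le, h2.2⟩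
  choose q hqx hqy using hstrip
  -- the `i`-th coordinate in terms of the strips alone
  have key : ∀ w : Fin m → ℝ, IsLatticePoint w →
      (∀ j, (q j : ℝ) * m ≤ w i - w j ∧ w i - w j < ((q j : ℝ) + 1) * m) →
      (m : ℝ) * w i = m * ∑ j, (q j : ℝ) + ∑ r : ZMod m, (r.val : ℝ) := by
    intro w hw hq
    choose z hz using hw.integral
    have hr : ∀ j, (((z j - z i : ℤ) : ZMod m).val : ℤ) = z j - z i - m * q j := by
      intro j
      rw [ZMod.val_intCast]
      have h1 : ((q j * m : ℤ) : ℝ) ≤ ((z j - z i : ℤ) : ℝ) := by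
        push_cast; linarith [(hq j).1, hz i, hz j]
      have h2 : ((z j - z i : ℤ) : ℝ) < (((q j + 1) * m : ℤ) : ℝ) := by
        push_cast; linarith [(hq j).2, hz i, hz j]
      have h1' : q j * m ≤ z j - z i := by exact_mod_cast h1
      have h2' : z j - z i < (q j + 1) * m := by exact_mod_cast h2
      have : (z j - z i) % (m : ℤ) = (z j - z i - m * q j) % m := by
        rw [Int.sub_mul_emod_self_left]
      rw [this]
      exact Int.emod_eq_of_lt (by linarith) (by linarith)
    have hbij : Function.Bijective fun j => ((z j - z i : ℤ) : ZMod m) := by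
      rw [Fintype.bijective_iff_injective_and_card]
      refine ⟨fun a b hab => ?_, by simp [ZMod.card]⟩
      by_contra hne
      have hdvd := (ZMod.intCast_eq_intCast_iff_dvd_sub _ _ _).1 hab
      obtain ⟨e, he⟩ := hdvd
      refine hw.ne_mul a b hne e ?_
      have he' : ((z b - z i - (z a - z i) : ℤ) : ℝ) = ((m * e : ℤ) : ℝ) := by rw [he]
      push_cast at he'
      linarith [hz a, hz b]
    have hs := hbij.sum_comp fun r : ZMod m => (r.val : ℝ)
    rw [← hs]
    have hr' : ∀ j, ((((z j - z i : ℤ) : ZMod m).val : ℕ) : ℝ) = w i - w j - m * q j := by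
      intro j
      have := congrArg (Int.cast (R := ℝ)) (hr j)
      push_cast at this
      push_cast
      rw [this]
      linarith [hz i, hz j]
    simp only [hr', Finset.sum_sub_distrib, hw.sum_eq, ← Finset.mul_sum]
    simp
  have h1 := key x hx hqx
  rw [← key y hy hqy] at h1
  exact mul_left_cancel₀ (NeZero.ne (m : ℝ)) h1

/-- A finite family of lattice points that is permuted by the action of a word of length `n` coprime
to `m` consists of one point only. Distances in the family cannot decrease, so the word acts on all
members by one and the same permutation of the coordinates, which is an `m`-cycle. Hence the order
of any two coordinates is reversed at some time, and this fixes the strip of their difference. -/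
theorem eq_of_permuted_family {n : ℕ} (hmn : Nat.Coprime m n) (q : ℕ → Fin m) {ι : Type*}
    [Fintype ι] {y : ι → Fin m → ℝ} (hy : ∀ k, IsLatticePoint (y k)) (π : Equiv.Perm ι)
    (hπ : ∀ k, run q (y k) n = y (π k)) (k l : ι) : y k = y l := by
  have hle : ∀ kl : ι × ι,
      sqDist (run q (y kl.1) n) (run q (y kl.2) n) ≤ sqDist (y kl.1) (y kl.2) :=
    fun kl => antitone_sqDist_run q _ _ (Nat.zero_le n)
  have hsum : ∑ kl : ι × ι, sqDist (run q (y kl.1) n) (run q (y kl.2) n)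
      = ∑ kl : ι × ι, sqDist (y kl.1) (y kl.2) := by
    simp only [hπ]
    exact Equiv.sum_comp (π.prodCongr π) fun kl => sqDist (y kl.1) (y kl.2)
  have hd : ∀ k l, sqDist (run q (y k) n) (run q (y l) n) = sqDist (y k) (y l) := fun k l =>
    (Finset.sum_eq_sum_iff_of_le fun kl _ => hle kl).1 hsum (k, l) (Finset.mem_univ _)
  obtain ⟨σ, c, h, hord⟩ := exists_common_perm_run hy q n hd
  -- the barycentre of the family satisfies the relation of a fixed point
  have hι : (Fintype.card ι : ℝ) ≠ 0 := by
    have : Nonempty ι := ⟨k⟩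
    exact_mod_cast Fintype.card_ne_zero
  have hY : ∀ i, (∑ k, y k i) / Fintype.card ι
      = (∑ k, y k (σ i)) / Fintype.card ι + (m : ℝ) * (c i : ℝ) - (n : ℝ) := by
    intro i
    rw [← Equiv.sum_comp π fun k => y k i]
    simp only [← hπ, h, Finset.sum_sub_distrib, Finset.sum_add_distrib]
    simp only [Finset.sum_const, Finset.card_univ, nsmul_eq_mul]
    field_simp
  have hcyc := bijective_pow_apply_of_relation
    (Y := fun i => (∑ k, y k i) / Fintype.card ι) hmn hY
  have hrank : ∀ i, ∑ a : Fin m, (((σ ^ (a : ℕ)) i : Fin m) : ℕ) = ∑ r : Fin m, (r : ℕ) :=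
    fun i => (hcyc i).sum_comp fun r : Fin m => (r : ℕ)
  have hback : ∀ i j, SameStrip y (σ i) (σ j) → SameStrip y i j := by
    intro i j hs
    have h1 : SameStrip (fun k => y (π k)) i j := by
      refine hs.of_relation (c i - c j) fun k => ?_
      rw [← hπ, h, h]
      push_cast
      ring
    obtain ⟨r, hr⟩ := h1
    exact ⟨r, fun k => by simpa using hr (π.symm k)⟩
  have hall : ∀ i j, i ≠ j → SameStrip y i j := by
    intro i j hij
    by_contra hns
    have hpow : ∀ a : ℕ, ¬ SameStrip y ((σ ^ a) i) ((σ ^ a) j) ∧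
        (i < j ↔ (σ ^ a) i < (σ ^ a) j) := by
      intro a
      induction a with
      | zero => exact ⟨hns, Iff.rfl⟩
      | succ a ih =>
        rw [pow_succ', Equiv.Perm.mul_apply, Equiv.Perm.mul_apply]
        have h1 := fun hs => ih.1 (hback _ _ hs)
        exact ⟨h1, ih.2.trans ((hord _ _).resolve_right h1)⟩
    have hm : (Finset.univ : Finset (Fin m)).Nonempty := ⟨i, Finset.mem_univ _⟩
    rcases lt_or_gt_of_ne hij with hlt | hgt
    · refine absurd ((hrank i).trans (hrank j).symm) (Finset.sum_lt_sum_of_nonempty hm ?_).ne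
      exact fun a _ => (hpow a).2.1 hlt
    · refine absurd ((hrank j).trans (hrank i).symm) (Finset.sum_lt_sum_of_nonempty hm ?_).ne
      intro a _
      have h1 : ¬ (σ ^ (a : ℕ)) i < (σ ^ (a : ℕ)) j := fun h' => hgt.asymm ((hpow a).2.2 h')
      exact Fin.lt_def.1 (lt_of_le_of_ne (not_lt.1 h1) ((σ ^ (a : ℕ)).injective.ne hij.symm))
  refine (hy k).eq_of_sameStrip (hy l) fun i j hij => ?_
  obtain ⟨q, hq⟩ := hall i j hij
  exact ⟨q, hq k, hq l⟩

/-! ### Orbits of parking functions are bounded -/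

/-- The number of letters smaller than `i` among `q 0, …, q (t - 1)`. -/
def smallLetters (q : ℕ → Fin m) (t i : ℕ) : ℕ :=
  ((Finset.range t).filter fun j => (q j : ℕ) < i).card

theorem smallLetters_succ (q : ℕ → Fin m) (t i : ℕ) :
    smallLetters q (t + 1) i = smallLetters q t i + if (q t : ℕ) < i then 1 else 0 := by
  unfold smallLetters
  rw [Finset.range_add_one, Finset.filter_insert]
  split_ifs
  · rw [Finset.card_insert_of_notMem (by simp)]
  · rfl

theorem smallLetters_mono (q : ℕ → Fin m) (t : ℕ) : Monotone (smallLetters q t) :=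
  fun _ _ hij => Finset.card_le_card fun _ hj => by
    simp only [Finset.mem_filter] at hj ⊢
    exact ⟨hj.1, hj.2.trans_le hij⟩

theorem smallLetters_le (q : ℕ → Fin m) (t i : ℕ) : smallLetters q t i ≤ t :=
  (Finset.card_filter_le _ _).trans (Finset.card_range t).le

theorem sum_letterShift (l : Fin m) (x : Fin m → ℝ) (s : Finset (Fin m)) :
    ∑ j ∈ s, letterShift l x j
      = ∑ j ∈ s, x j + (if l ∈ s then (m : ℝ) else 0) - (s.card : ℝ) := by
  unfold letterShift
  have : ∀ j, (if j = l then x j + (m : ℝ) else x j) = x j + if j = l then (m : ℝ) else 0 := by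
    intro j; split_ifs <;> simp
  simp only [this, Finset.sum_sub_distrib, Finset.sum_add_distrib]
  simp

/-- Sums over sets of `i` coordinates are bounded below by `-B i (m - i)`, corrected by the drift that
the `i` smallest coordinates have when they are far below the other ones. The bound is strongly
concave in `i`; hence, where it is nearly attained, there is a large gap behind the `i` smallest
coordinates, and every letter smaller than `i` does act on one of these. -/
theorem le_sum_run {B : ℝ} {n : ℕ} (hB : (m : ℝ) + m * n ≤ B) (q : ℕ → Fin m) {x : Fin m → ℝ}
    (hmono : Monotone x)
    (h0 : ∀ s : Finset (Fin m), -(B * (s.card * (m - s.card))) ≤ ∑ j ∈ s, x j)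
    {t : ℕ} (ht : t ≤ n) (s : Finset (Fin m)) :
    -(B * (s.card * (m - s.card))) + m * smallLetters q t s.card - s.card * t
      ≤ ∑ j ∈ s, run q x t j := by
  induction t generalizing s with
  | zero => simpa [run, smallLetters] using h0 s
  | succ t ih =>
    have ih := ih (Nat.le_of_succ_le ht)
    have hX : Monotone (run q x t) := by
      cases t with
      | zero => exact hmono
      | succ t => exact monotone_letterAct _ _
    set X := run q x t
    have hm : (0 : ℝ) ≤ m := Nat.cast_nonneg m
    have key : ∀ s : Finset (Fin m),
        -(B * (s.card * (m - s.card))) + m * smallLetters q (t + 1) s.card - s.card * (t + 1 : ℕ)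
          ≤ ∑ j ∈ s, letterShift (q t) X j := by
      intro s
      rw [sum_letterShift, smallLetters_succ]
      have ihs := ih s
      by_cases hl : q t ∈ s
      · rw [if_pos hl]
        split_ifs <;> push_cast <;> linarith
      rw [if_neg hl]
      by_cases hls : (q t : ℕ) < s.card
      swap
      · rw [if_neg hls]
        push_cast
        linarith
      rw [if_pos hls]
      obtain ⟨h, hh, hlh⟩ : ∃ h ∈ s, q t < h := by
        by_contra hcon
        push Not at hcon
        have hsub : s ⊆ Finset.Iio (q t) := fun a ha =>
          Finset.mem_Iio.2 (lt_of_le_of_ne (hcon a ha) fun e => hl (e ▸ ha))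
        have := Finset.card_le_card hsub
        rw [Fin.card_Iio] at this
        omega
      have i1 := ih (insert (q t) s)
      have i2 := ih (s.erase h)
      rw [Finset.sum_insert hl, Finset.card_insert_of_notMem hl] at i1
      have hsum := Finset.add_sum_erase s X hh
      rw [Finset.card_erase_of_mem hh] at i2
      obtain ⟨i, hi⟩ : ∃ i, s.card = i + 1 := Nat.exists_eq_succ_of_ne_zero (by omega)
      rw [hi] at ihs i1 i2 ⊢
      rw [Nat.add_sub_cancel] at i2
      have c1 : (smallLetters q t (i + 1) : ℝ) ≤ smallLetters q t (i + 1 + 1) := by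
        exact_mod_cast smallLetters_mono q t (Nat.le_succ _)
      have c2 : (smallLetters q t (i + 1) : ℝ) ≤ smallLetters q t i + n := by
        have := smallLetters_le q t (i + 1)
        exact_mod_cast (by omega : smallLetters q t (i + 1) ≤ smallLetters q t i + n)
      have c3 := mul_le_mul_of_nonneg_left c1 hm
      have c4 := mul_le_mul_of_nonneg_left c2 hm
      have hmn : (0 : ℝ) ≤ m * n := by positivity
      have hle := hX hlh.le
      push_cast at i1 i2 ⊢
      linarith
    have hk := key (s.map (Tuple.sort (letterShift (q t) X)).toEmbedding)
    rw [Finset.card_map, Finset.sum_map] at hk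
    exact hk

/-- The letters of a word, repeated periodically. -/
def periodicLetters {n : ℕ} [NeZero n] (p : Fin n → Fin m) (t : ℕ) : Fin m :=
  p ⟨t % n, Nat.mod_lt t (NeZero.pos n)⟩

theorem periodicLetters_add {n : ℕ} [NeZero n] (p : Fin n → Fin m) (t : ℕ) :
    periodicLetters p (t + n) = periodicLetters p t := by
  simp [periodicLetters]

theorem periodicLetters_add_mul {n : ℕ} [NeZero n] (p : Fin n → Fin m) (t k : ℕ) :
    periodicLetters p (t + k * n) = periodicLetters p t := by
  simp [periodicLetters]

theorem periodicLetters_val {n : ℕ} [NeZero n] (p : Fin n → Fin m) (i : Fin n) :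
    periodicLetters p i = p i := by
  simp [periodicLetters, Nat.mod_eq_of_lt i.2]

theorem wordAct_eq_run {n : ℕ} [NeZero n] (p : Fin n → Fin m) (x : Fin m → ℝ) :
    wordAct p x = run (periodicLetters p) x n :=
  foldl_ofFn_eq_run p _ (periodicLetters_val p) x

theorem run_add_period {n : ℕ} [NeZero n] (p : Fin n → Fin m) (x : Fin m → ℝ) (k t : ℕ) :
    run (periodicLetters p) x (k * n + t) =
      run (periodicLetters p) ((wordAct p)^[k] x) t := by
  induction k generalizing x with
  | zero => simp
  | succ k ih =>
    rw [Function.iterate_succ_apply, ← ih, wordAct_eq_run, add_mul, one_mul, add_comm (k * n) n,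
      add_assoc, run_add]
    congr 1
    funext s
    rw [add_comm, periodicLetters_add]

theorem IsParkingFunction.mul_le_smallLetters {n : ℕ} [NeZero m] [NeZero n] {p : Fin n → Fin m}
    (hp : IsParkingFunction p) {i : ℕ} (hi : i ≤ m) :
    i * n ≤ m * smallLetters (periodicLetters p) n i := by
  rcases Nat.eq_zero_or_pos i with rfl | hi0
  · simp
  have h := hp i hi0 hi
  have hm : (0 : ℚ) < m := Nat.cast_pos.2 (NeZero.pos m)
  rw [div_le_iff₀ hm] at h
  have hc : smallLetters (periodicLetters p) n i
      = (Finset.univ.filter fun j : Fin n => (p j : ℕ) < i).card := by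
    unfold smallLetters
    rw [Finset.card_filter, Finset.card_filter,
      ← Fin.sum_univ_eq_sum_range (fun j => if (periodicLetters p j : ℕ) < i then 1 else 0) n]
    simp only [periodicLetters_val]
  rw [hc, mul_comm m]
  exact_mod_cast h

theorem IsLatticePoint.wordAct_iterate {n : ℕ} [NeZero n] (p : Fin n → Fin m) {x : Fin m → ℝ}
    (hx : IsLatticePoint x) (k : ℕ) : IsLatticePoint ((wordAct p)^[k] x) := by
  have := hx.run (periodicLetters p) (k * n)
  rwa [← add_zero (k * n), run_add_period] at this

theorem finite_setOf_isLatticePoint (B : ℝ) :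
    {x : Fin m → ℝ | IsLatticePoint x ∧
      ∀ s : Finset (Fin m), -(B * (s.card * (m - s.card))) ≤ ∑ j ∈ s, x j}.Finite := by
  obtain ⟨Z, hZ⟩ := exists_nat_ge (B * (m - 1) + m + 1)
  refine ((Set.finite_Icc (fun _ : Fin m => -(Z : ℤ)) fun _ => (Z : ℤ)).image
    fun z i => ((m : ℝ) + 1) / 2 - (z i : ℝ)).subset ?_
  rintro x ⟨hx, hs⟩
  choose z hz using hx.integral
  refine ⟨z, ?_, funext fun i => by simp only [← hz]; ring⟩
  rw [Set.mem_Icc, Pi.le_def, Pi.le_def, ← forall_and]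
  intro i
  have hm : 1 ≤ m := i.pos
  have hm' : (1 : ℝ) ≤ m := by exact_mod_cast hm
  have h1 := hs {i}
  have h2 := hs (Finset.univ.erase i)
  have h3 := Finset.add_sum_erase Finset.univ x (Finset.mem_univ i)
  rw [hx.sum_eq] at h3
  rw [Finset.card_erase_of_mem (Finset.mem_univ i), Finset.card_univ, Fintype.card_fin,
    Nat.cast_sub hm] at h2
  simp only [Finset.card_singleton, Nat.cast_one, one_mul, Finset.sum_singleton] at h1
  have h4 : B * (((m : ℝ) - 1) * (m - (m - 1))) = B * (m - 1) := by ring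
  rw [Nat.cast_one, h4] at h2
  constructor
  · have : (-(Z : ℤ) : ℝ) ≤ (z i : ℝ) := by
      push_cast; rw [← hz]; linarith
    exact_mod_cast this
  · have : (z i : ℝ) ≤ ((Z : ℤ) : ℝ) := by
      push_cast; rw [← hz]; linarith
    exact_mod_cast this

theorem IsParkingFunction.finite_range_iterate {n : ℕ} [NeZero m] [NeZero n] {p : Fin n → Fin m}
    (hp : IsParkingFunction p) {x : Fin m → ℝ} (hx : IsLatticePoint x) :
    (Set.range fun k => (wordAct p)^[k] x).Finite := by
  set B : ℝ := (m : ℝ) + m * n + ∑ i, |x i| with hBdef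
  have hpos : 0 ≤ ∑ i, |x i| := Finset.sum_nonneg fun i _ => abs_nonneg _
  have hB : (m : ℝ) + m * n ≤ B := by linarith
  have hB0 : ∑ i, |x i| ≤ B := by
    have : (0 : ℝ) ≤ (m : ℝ) + m * n := by positivity
    linarith
  refine (finite_setOf_isLatticePoint (m := m) B).subset ?_
  rintro _ ⟨k, rfl⟩
  refine ⟨hx.wordAct_iterate p k, ?_⟩
  induction k with
  | zero =>
    intro s
    simp only [Function.iterate_zero, id]
    rcases (Finset.card_le_univ s).eq_or_lt with h | h
    · rw [(Finset.card_eq_iff_eq_univ s).1 h, hx.sum_eq]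
      simp
    rcases s.eq_empty_or_nonempty with rfl | hs
    · simp
    rw [Fintype.card_fin] at h
    have h1 : -B ≤ ∑ j ∈ s, x j := by
      have h2 : ∑ j ∈ s, -|x j| ≤ ∑ j ∈ s, x j := Finset.sum_le_sum fun j _ => neg_abs_le _
      have h3 : ∑ j ∈ s, |x j| ≤ ∑ j, |x j| :=
        Finset.sum_le_sum_of_subset_of_nonneg (Finset.subset_univ s) fun _ _ _ => abs_nonneg _
      rw [Finset.sum_neg_distrib] at h2
      linarith
    have h2 : (1 : ℝ) ≤ s.card := by exact_mod_cast hs.card_pos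
    have h3 : (1 : ℝ) ≤ m - s.card := by
      have : (s.card : ℝ) + 1 ≤ m := by exact_mod_cast h
      linarith
    have h4 := mul_le_mul_of_nonneg_left (one_le_mul_of_one_le_of_one_le h2 h3)
      (hpos.trans hB0)
    linarith
  | succ k ih =>
    intro s
    simp only [Function.iterate_succ_apply', wordAct_eq_run p ((wordAct p)^[k] x)]
    have h1 := le_sum_run hB (periodicLetters p) (hx.wordAct_iterate p k).mono ih le_rfl s
    have h2 : (s.card : ℝ) * n ≤ m * smallLetters (periodicLetters p) n s.card := by
      exact_mod_cast hp.mul_le_smallLetters (card_finset_fin_le s)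
    linarith

/-- The orbit of a lattice point under a parking function ends in a fixed point: it is finite,
so ends in a cycle, which is a family of lattice points permuted by the word. -/
theorem IsParkingFunction.exists_isFixedPt_iterate {n : ℕ} [NeZero m] [NeZero n]
    (hmn : Nat.Coprime m n) {p : Fin n → Fin m} (hp : IsParkingFunction p) {x : Fin m → ℝ}
    (hx : IsLatticePoint x) :
    ∃ a, wordAct p ((wordAct p)^[a] x) = (wordAct p)^[a] x := by
  obtain ⟨a, b, hab, hfab⟩ := (hp.finite_range_iterate hx).exists_lt_map_eq_of_forall_mem
    (f := fun k => (wordAct p)^[k] x) fun k => Set.mem_range_self k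
  obtain ⟨l, rfl⟩ := Nat.exists_eq_add_of_lt hab
  refine ⟨a, ?_⟩
  have hstep : ∀ k : Fin (l + 1), run (periodicLetters p) ((wordAct p)^[a + k] x) n
      = (wordAct p)^[a + (finRotate (l + 1) k : Fin (l + 1))] x := by
    intro k
    rw [← wordAct_eq_run, ← Function.iterate_succ_apply' (wordAct p)]
    rcases (Fin.le_last k).eq_or_lt with rfl | hk
    · simpa [finRotate_last, add_assoc] using hfab.symm
    · have hv := coe_finRotate_of_ne_last hk.ne
      rw [hv]
      rfl
  have := eq_of_permuted_family hmn (periodicLetters p)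
    (y := fun k : Fin (l + 1) => (wordAct p)^[a + k] x)
    (fun k => hx.wordAct_iterate p _) (finRotate (l + 1)) hstep (finRotate (l + 1) 0) 0
  have h0 := hstep 0
  beta_reduce at this
  rw [this, ← wordAct_eq_run] at h0
  simpa using h0

theorem IsLatticePoint.eq_of_wordAct_eq {n : ℕ} [NeZero n] (hmn : Nat.Coprime m n)
    {p : Fin n → Fin m} {x y : Fin m → ℝ} (hx : IsLatticePoint x) (hy : IsLatticePoint y)
    (hpx : wordAct p x = x) (hpy : wordAct p y = y) : x = y := by
  rw [wordAct_eq_run] at hpx hpy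
  exact eq_of_permuted_family hmn (periodicLetters p) (y := fun b : Bool => if b then x else y)
    (by rintro (_ | _) <;> simpa) (Equiv.refl Bool) (by rintro (_ | _) <;> simpa) true false

theorem isLatticePoint_of_wordAct_eq {n : ℕ} [NeZero m] [NeZero n] (hmn : Nat.Coprime m n)
    {p : Fin n → Fin m} {x : Fin m → ℝ} (hx : x ∈ weylChamber m) (hpx : wordAct p x = x) :
    IsLatticePoint x := by
  rw [wordAct_eq_run] at hpx
  exact isLatticePoint_of_run_eq hmn _ hx.2 hx.1 hpx

/-! ### Alcoves and their centroids -/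

theorem IsLatticePoint.ball_inter_subset {x : Fin m → ℝ} (hx : IsLatticePoint x) :
    Metric.ball x (1 / 2) ∩ sumZero m ⊆ braidComplement m := by
  rintro y ⟨hy, hy0⟩
  refine ⟨hy0, fun i j hij k hk => ?_⟩
  have hd : ∀ i, |y i - x i| < 1 / 2 := fun i => by
    rw [← Real.dist_eq]
    exact (dist_le_pi_dist y x i).trans_lt hy
  obtain ⟨a, ha⟩ := hx.integral i
  obtain ⟨b, hb⟩ := hx.integral j
  have h1 := abs_lt.1 (hd i)
  have h2 := abs_lt.1 (hd j)
  -- `x i - x j - k m` is an integer in the interval `(-1, 1)`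
  have h3 : ((b - a - k * m : ℤ) : ℝ) < (1 : ℤ) := by push_cast; linarith
  have h4 : ((-1 : ℤ) : ℝ) < ((b - a - k * m : ℤ) : ℝ) := by push_cast; linarith
  have h5 : b - a - k * m < 1 := by exact_mod_cast h3
  have h6 : -1 < b - a - k * m := by exact_mod_cast h4
  have h7 : b - a - k * m = 0 := by omega
  have h8 : ((b - a - k * m : ℤ) : ℝ) = 0 := by rw [h7]; simp
  push_cast at h8
  exact hx.ne_mul i j hij.ne k (by linarith)

theorem convex_sumZero (m : ℕ) : Convex ℝ (sumZero m) := by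
  intro x hx y hy a b _ _ _
  have hx' : ∑ i, x i = 0 := hx
  have hy' : ∑ i, y i = 0 := hy
  simp [sumZero, Finset.sum_add_distrib, ← Finset.mul_sum, hx', hy']

theorem IsLatticePoint.exists_isAlcoveCentroid {x : Fin m → ℝ} (hx : IsLatticePoint x) :
    ∃ A, IsAlcove m A ∧ IsAlcoveCentroid A x := by
  have hsub := hx.ball_inter_subset
  have hmem : x ∈ Metric.ball x (1 / 2) ∩ sumZero m :=
    ⟨Metric.mem_ball_self (by norm_num), hx.sum_eq⟩
  refine ⟨_, ⟨x, hsub hmem, rfl⟩, hx.sum_eq, ?_, hx.integral⟩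
  refine Metric.mem_nhdsWithin_iff.2 ⟨1 / 2, by norm_num, ?_⟩
  have hpre : IsPreconnected (Metric.ball x (1 / 2) ∩ sumZero m) :=
    ((convex_ball x _).inter (convex_sumZero m)).isPreconnected
  exact (hpre.subset_connectedComponentIn hmem hsub).trans subset_closure

/-- The centroid of the fundamental alcove, with coordinates `i - (m - 1) / 2`. -/
noncomputable def fundamentalCentroid (m : ℕ) : Fin m → ℝ :=
  fun i => ((i : ℕ) : ℝ) - ((m : ℝ) - 1) / 2

theorem isLatticePoint_fundamentalCentroid (m : ℕ) [NeZero m] :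
    IsLatticePoint (fundamentalCentroid m) where
  mono i j hij := by
    have : ((i : ℕ) : ℝ) ≤ ((j : ℕ) : ℝ) := by exact_mod_cast hij
    simp only [fundamentalCentroid]
    linarith
  sum_eq := by
    simp only [fundamentalCentroid, Finset.sum_sub_distrib]
    rw [Fin.sum_univ_eq_sum_range (fun k => (k : ℝ)) m]
    have h2 := congrArg (Nat.cast (R := ℝ)) (Finset.sum_range_id_mul_two m)
    push_cast [Nat.cast_sub (NeZero.one_le : 1 ≤ m)] at h2
    simp only [Finset.sum_const, Finset.card_univ, Fintype.card_fin, nsmul_eq_mul]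
    linarith
  integral i := ⟨(m : ℤ) - (i : ℕ), by simp only [fundamentalCentroid]; push_cast; ring⟩
  ne_mul i j hij k h := by
    refine hij (eq_of_dvd_sub_mul (n := 1) (by simp) (e := k) ?_)
    simp only [fundamentalCentroid] at h
    push_cast
    linarith

theorem isAlcoveCentroid_fundamentalCentroid (m : ℕ) [NeZero m] :
    IsAlcoveCentroid (fundamentalAlcove m) (fundamentalCentroid m) := by
  have hx := isLatticePoint_fundamentalCentroid m
  refine ⟨hx.sum_eq, Metric.mem_nhdsWithin_iff.2 ⟨1 / 2, by norm_num, ?_⟩, hx.integral⟩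
  rintro y ⟨hy, hy0⟩
  have hd : ∀ i, -(1 / 2) < y i - fundamentalCentroid m i ∧
      y i - fundamentalCentroid m i < 1 / 2 := fun i => by
    rw [← abs_lt, ← Real.dist_eq]
    exact (dist_le_pi_dist y _ i).trans_lt hy
  simp only [fundamentalCentroid] at hd
  refine ⟨hy0, fun i j hij => ?_, fun i => ?_⟩
  · rcases hij.eq_or_lt with rfl | hij
    · exact le_rfl
    have h1 : ((i : ℕ) : ℝ) + 1 ≤ ((j : ℕ) : ℝ) := by exact_mod_cast hij
    linarith [(hd i).2, (hd j).1]
  · have h1 : ((i : ℕ) : ℝ) + 1 ≤ m := by exact_mod_cast i.2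
    have h2 := (hd 0).1
    have h3 : (((0 : Fin m) : ℕ) : ℝ) = 0 := by simp
    linarith [(hd i).2]

/-- Inside `A`, a small amount can be moved from one coordinate to another at any point of the
interior of `A` relative to `W`. -/
theorem exists_pos_add_sub_mem {A : Set (Fin m → ℝ)} {x : Fin m → ℝ} (hx : x ∈ sumZero m)
    (hA : A ∈ 𝓝[sumZero m] x) (i j : Fin m) :
    ∃ δ > 0, x + Pi.single i δ - Pi.single j δ ∈ A := by
  obtain ⟨ε, hε, hsub⟩ := Metric.mem_nhdsWithin_iff.1 hA
  refine ⟨ε / 4, by positivity, hsub ⟨?_, ?_⟩⟩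
  · have h1 : ‖(Pi.single i (ε / 4) : Fin m → ℝ)‖ = ε / 4 := by
      rw [Pi.norm_single, Real.norm_of_nonneg (by positivity)]
    have h2 : ‖(Pi.single j (ε / 4) : Fin m → ℝ)‖ = ε / 4 := by
      rw [Pi.norm_single, Real.norm_of_nonneg (by positivity)]
    rw [Metric.mem_ball, dist_eq_norm, add_sub_assoc, add_sub_cancel_left]
    exact (norm_sub_le _ _).trans_lt (by rw [h1, h2]; linarith)
  · have hx' : ∑ i, x i = 0 := hx
    simp [sumZero, Finset.sum_sub_distrib, Finset.sum_add_distrib, hx']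

theorem eq_fundamentalCentroid [NeZero m] {x : Fin m → ℝ}
    (hx : IsAlcoveCentroid (fundamentalAlcove m) x) : x = fundamentalCentroid m := by
  obtain ⟨h0, hA, hint⟩ := hx
  have hlt : ∀ i j, i < j → x i < x j := by
    intro i j hij
    obtain ⟨δ, hδ, -, hmono, -⟩ := exists_pos_add_sub_mem h0 hA i j
    have := hmono hij.le
    simp only [Pi.sub_apply, Pi.add_apply, Pi.single_eq_same, Pi.single_eq_of_ne hij.ne,
      Pi.single_eq_of_ne hij.ne'] at this
    linarith
  have hlast : ∀ i, x i < x 0 + m := by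
    intro i
    have hm : (0 : ℝ) < m := Nat.cast_pos.2 (NeZero.pos m)
    rcases eq_or_ne i 0 with rfl | hi
    · linarith
    obtain ⟨δ, hδ, -, -, hle⟩ := exists_pos_add_sub_mem h0 hA i 0
    have := hle i
    simp only [Pi.sub_apply, Pi.add_apply, Pi.single_eq_same, Pi.single_eq_of_ne hi,
      Pi.single_eq_of_ne hi.symm] at this
    linarith
  choose z hz using hint
  have hz_lt : ∀ i j, i < j → z j < z i := fun i j hij => by
    have := hlt i j hij
    have h : (z j : ℝ) < z i := by linarith [hz i, hz j]
    exact_mod_cast h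
  have hz0 : ∀ i, z i ≤ z 0 := fun i => by
    rcases (Fin.zero_le i).eq_or_lt with h | h
    · rw [← h]
    · exact (hz_lt _ _ h).le
  have hzm : ∀ i, z 0 < z i + m := fun i => by
    have := hlast i
    have h : (z 0 : ℝ) < z i + m := by linarith [hz i, hz 0]
    exact_mod_cast h
  -- `z 0 - z` is an order embedding of `Fin m` into itself
  let f : Fin m → Fin m := fun i => ⟨(z 0 - z i).toNat, by have := hz0 i; have := hzm i; omega⟩
  have hf : StrictMono f := fun i j hij => by
    have := hz_lt i j hij
    have := hz0 i
    have := hz0 j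
    simp only [f, Fin.mk_lt_mk]
    omega
  have hfi : ∀ i, f i = i := fun i => le_antisymm hf.apply_le hf.le_apply
  have hxi : ∀ i, x i = x 0 + ((i : ℕ) : ℝ) := fun i => by
    have h1 := congrArg Fin.val (hfi i)
    simp only [f] at h1
    have h2 := hz0 i
    have h3 : z 0 - z i = ((i : ℕ) : ℤ) := by omega
    have h4 := congrArg (Int.cast (R := ℝ)) h3
    push_cast at h4
    linarith [hz i, hz 0]
  have hsum : ∑ i, x i = ∑ i, fundamentalCentroid m i := by
    rw [(isLatticePoint_fundamentalCentroid m).sum_eq]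
    exact h0
  have hd : ∑ i, (x i - fundamentalCentroid m i) = 0 := by
    rw [Finset.sum_sub_distrib, hsum, sub_self]
  have hc : ∀ i, x i - fundamentalCentroid m i = x 0 + (m - 1) / 2 := fun i => by
    rw [hxi i]; simp only [fundamentalCentroid]; ring
  simp only [hc, Finset.sum_const, Finset.card_univ, Fintype.card_fin, nsmul_eq_mul,
    mul_eq_zero, NeZero.ne, false_or] at hd
  funext i
  linarith [hc i]

/-! ### The second algorithm follows the orbit of the centroid of the fundamental alcove -/

theorem count_image_of_strictMono {s : Fin m → ℕ} (hs : StrictMono s) (k : Fin m) :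
    Nat.count (fun a => a ∈ Finset.univ.image s) (s k) = k := by
  rw [Nat.count_eq_card_filter_range]
  have : (Finset.range (s k)).filter (fun a => a ∈ Finset.univ.image s)
      = (Finset.Iio k).image s := by
    ext a
    simp only [Finset.mem_filter, Finset.mem_range, Finset.mem_image, Finset.mem_univ, true_and,
      Finset.mem_Iio]
    constructor
    · rintro ⟨h, j, rfl⟩
      exact ⟨j, hs.lt_iff_lt.1 h, rfl⟩
    · rintro ⟨j, h, rfl⟩
      exact ⟨hs h, j, rfl⟩
  rw [this, Finset.card_image_of_injective _ hs.injective, Fin.card_Iio]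

theorem nth_image_of_strictMono {s : Fin m → ℕ} (hs : StrictMono s) (k : Fin m) :
    Nat.nth (fun a => a ∈ Finset.univ.image s) k = s k := by
  conv_lhs => rw [← count_image_of_strictMono hs k]
  exact Nat.nth_count (by simp)

/-- The increasing enumeration of the set `S_t` is the configuration reached from the centroid of
the fundamental alcove, up to a translation that depends on `t` only. -/
theorem exists_enum_mtwSet [NeZero m] (q : ℕ → Fin m) (t : ℕ) :
    ∃ s : Fin m → ℕ, StrictMono s ∧
      mtwSet m (fun t => (q t : ℕ)) t = Finset.univ.image s ∧
      ∀ j, (s j : ℝ) = run q (fundamentalCentroid m) t j + ((m : ℝ) - 1) / 2 + t := by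
  induction t with
  | zero =>
    refine ⟨fun j => j, Fin.val_strictMono, ?_, fun j => ?_⟩
    · ext a
      simp only [mtwSet, Finset.mem_range, Finset.mem_image, Finset.mem_univ, true_and]
      exact ⟨fun h => ⟨⟨a, h⟩, rfl⟩, fun ⟨j, h⟩ => h ▸ j.2⟩
    · simp [run, fundamentalCentroid]
  | succ t ih =>
    obtain ⟨s, hs, hS, hsx⟩ := ih
    set X := run q (fundamentalCentroid m) t with hX
    set τ := Tuple.sort (letterShift (q t) X) with hτ
    have hval : ∀ j, ((if τ j = q t then s (τ j) + m else s (τ j) : ℕ) : ℝ)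
        = run q (fundamentalCentroid m) (t + 1) j + ((m : ℝ) - 1) / 2 + (t + 1 : ℕ) := by
      intro j
      simp only [run, letterAct_eq_comp_sort, Function.comp_apply, ← hX, ← hτ, letterShift]
      split_ifs
      · push_cast
        rw [hsx]
        ring
      · push_cast
        rw [hsx]
        ring
    refine ⟨fun j => if τ j = q t then s (τ j) + m else s (τ j), fun i j hij => ?_, ?_, hval⟩
    · have h := ((isLatticePoint_fundamentalCentroid m).run q (t + 1)).strictMono hij
      have h1 := hval i
      have h2 := hval j
      have h3 : ((if τ i = q t then s (τ i) + m else s (τ i) : ℕ) : ℝ)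
          < ((if τ j = q t then s (τ j) + m else s (τ j) : ℕ) : ℝ) := by
        rw [h1, h2]
        linarith
      exact_mod_cast h3
    · simp only [mtwSet]
      rw [hS, nth_image_of_strictMono hs]
      ext a
      simp only [Finset.mem_insert, Finset.mem_erase, Finset.mem_image, Finset.mem_univ, true_and]
      constructor
      · rintro (rfl | ⟨hne, j, rfl⟩)
        · exact ⟨τ.symm (q t), by simp⟩
        · refine ⟨τ.symm j, ?_⟩
          have : j ≠ q t := fun e => hne (by rw [e])
          simp [this]
      · rintro ⟨j, rfl⟩
        by_cases h : τ j = q t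
        · left; simp [h]
        · right
          rw [if_neg h]
          exact ⟨fun e => h (hs.injective e), _, rfl⟩

theorem mtwV_mem [NeZero m] (q : ℕ → Fin m) (t : ℕ) :
    mtwV m (fun t => (q t : ℕ)) t ∈ mtwSet m (fun t => (q t : ℕ)) t := by
  obtain ⟨s, hs, hS, -⟩ := exists_enum_mtwSet q t
  unfold mtwV
  rw [hS, nth_image_of_strictMono hs]
  simp

theorem count_mtwV [NeZero m] (q : ℕ → Fin m) (t : ℕ) :
    Nat.count (fun a => a ∈ mtwSet m (fun t => (q t : ℕ)) t) (mtwV m (fun t => (q t : ℕ)) t)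
      = q t := by
  obtain ⟨s, hs, hS, -⟩ := exists_enum_mtwSet q t
  unfold mtwV
  simp only [hS]
  rw [nth_image_of_strictMono hs, count_image_of_strictMono hs]

theorem mtwV_eq_run [NeZero m] (q : ℕ → Fin m) (t : ℕ) :
    (mtwV m (fun t => (q t : ℕ)) t : ℝ)
      = run q (fundamentalCentroid m) t (q t) + ((m : ℝ) - 1) / 2 + t := by
  obtain ⟨s, hs, hS, hsx⟩ := exists_enum_mtwSet q t
  unfold mtwV
  rw [hS, nth_image_of_strictMono hs, hsx]

/-! ### The order in which the second algorithm uses the natural numbers -/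

section Values

variable {q : ℕ → ℕ}

/-- The elements of `S_t` are the first unused elements of the residue classes modulo `m`. -/
theorem mem_mtwSet_iff (hm : 0 < m) (hV : ∀ t, mtwV m q t ∈ mtwSet m q t) (t α : ℕ) :
    α ∈ mtwSet m q t ↔
      (∀ j < t, mtwV m q j ≠ α) ∧ (α < m ∨ ∃ j < t, mtwV m q j + m = α) := by
  induction t using Nat.strong_induction_on generalizing α with
  | _ t ih =>
    cases t with
    | zero => simp [mtwSet]
    | succ t =>
      have hnew : ∀ j ≤ t, mtwV m q j ≠ mtwV m q t + m := by
        intro j hj e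
        have hlt : j < t := lt_of_le_of_ne hj fun h => by subst h; omega
        obtain ⟨-, h | ⟨i, hi, h⟩⟩ := (ih j (by omega) _).1 (hV j)
        · omega
        · exact ((ih t (by omega) _).1 (hV t)).1 i (hi.trans hlt) (by omega)
      have hstep : α ∈ mtwSet m q (t + 1) ↔
          α = mtwV m q t + m ∨ α ≠ mtwV m q t ∧ α ∈ mtwSet m q t := by
        simp only [mtwSet, Finset.mem_insert, Finset.mem_erase]
        rfl
      rw [hstep, ih t (by omega)]
      constructor
      · rintro (rfl | ⟨h1, h2, h3⟩)
        · exact ⟨fun j hj => hnew j (by omega), Or.inr ⟨t, by omega, rfl⟩⟩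
        · refine ⟨fun j hj => ?_, h3.imp_right fun ⟨j, hj, h⟩ => ⟨j, by omega, h⟩⟩
          rcases (Nat.lt_succ_iff.1 hj).eq_or_lt with rfl | hj
          · exact h1.symm
          · exact h2 j hj
      · rintro ⟨h1, h2⟩
        by_cases hα : α = mtwV m q t + m
        · exact Or.inl hα
        refine Or.inr ⟨(h1 t (by omega)).symm, fun j hj => h1 j (by omega),
          h2.imp_right fun ⟨j, hj, h⟩ => ⟨j, ?_, h⟩⟩
        rcases (Nat.lt_succ_iff.1 hj).eq_or_lt with rfl | hj
        · exact absurd h.symm hα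
        · exact hj

theorem exists_lt_mtwV_add_eq (hm : 0 < m) (hV : ∀ t, mtwV m q t ∈ mtwSet m q t) {t : ℕ}
    (h : m ≤ mtwV m q t) : ∃ j < t, mtwV m q j + m = mtwV m q t :=
  ((mem_mtwSet_iff hm hV t _).1 (hV t)).2.resolve_left (by omega)

theorem injective_mtwV (hm : 0 < m) (hV : ∀ t, mtwV m q t ∈ mtwSet m q t) :
    Function.Injective (mtwV m q) := by
  intro i j hij
  by_contra hne
  rcases lt_or_gt_of_ne hne with h | h
  · exact ((mem_mtwSet_iff hm hV j _).1 (hV j)).1 i h hij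
  · exact ((mem_mtwSet_iff hm hV i _).1 (hV i)).1 j h hij.symm

theorem surjective_mtwV (hm : 0 < m) (hV : ∀ t, mtwV m q t ∈ mtwSet m q t)
    (hinf : ∀ α, ∃ t, ∀ s ∈ mtwSet m q t, α < s) : Function.Surjective (mtwV m q) := by
  intro α
  obtain ⟨t, ht⟩ := hinf α
  suffices h : ∀ β ≤ α, ∃ j < t, mtwV m q j = β by
    obtain ⟨j, -, hj⟩ := h α le_rfl
    exact ⟨j, hj⟩
  intro β
  induction β using Nat.strong_induction_on with
  | _ β ih =>
    intro hβ
    by_contra hcon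
    push Not at hcon
    have hmem : β ∉ mtwSet m q t := fun h => absurd (ht β h) (by omega)
    refine hmem ((mem_mtwSet_iff hm hV t β).2 ⟨hcon, ?_⟩)
    by_cases hβm : β < m
    · exact Or.inl hβm
    · obtain ⟨j, hj, h⟩ := ih (β - m) (by omega) (by omega)
      exact Or.inr ⟨j, hj, by omega⟩

open Classical in
/-- Each residue class that has an element of `S_t` below `α` has one unused element in the window
`[α - m, α)`. -/
theorem count_mtwSet (hm : 0 < m) (hV : ∀ t, mtwV m q t ∈ mtwSet m q t) (t α : ℕ) :
    Nat.count (fun a => a ∈ mtwSet m q t) α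
      = ((Finset.range α).filter fun β => α ≤ β + m ∧ ∀ j < t, mtwV m q j ≠ β).card := by
  have key : ∀ α, Nat.count (fun a => a ∈ mtwSet m q t) α
      + Nat.count (fun β => ∀ j < t, mtwV m q j ≠ β) (α - m)
      = Nat.count (fun β => ∀ j < t, mtwV m q j ≠ β) α := by
    intro α
    induction α with
    | zero => simp
    | succ α ih =>
      rw [Nat.count_succ, Nat.count_succ]
      rcases lt_or_ge α m with h | h
      · have h1 : α + 1 - m = α - m := by omega
        have h2 : α ∈ mtwSet m q t ↔ ∀ j < t, mtwV m q j ≠ α := by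
          rw [mem_mtwSet_iff hm hV]; simp [h]
        simp only [h1, h2]
        omega
      · have h1 : α + 1 - m = (α - m) + 1 := by omega
        have h3 : (∀ j < t, mtwV m q j ≠ α - m) → ∀ j < t, mtwV m q j ≠ α := by
          intro hu j hj e
          obtain ⟨i, hi, h'⟩ := exists_lt_mtwV_add_eq hm hV (t := j) (by omega)
          exact hu i (hi.trans hj) (by omega)
        have h4 : (∃ j < t, mtwV m q j + m = α) ↔ ¬ ∀ j < t, mtwV m q j ≠ α - m := by
          push Not
          exact exists_congr fun j => and_congr_right fun _ => by omega
        have h2 := mem_mtwSet_iff hm hV t α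
        rw [h4] at h2
        have h5 : ¬ α < m := by omega
        rw [h1, Nat.count_succ]
        by_cases hu : ∀ j < t, mtwV m q j ≠ α - m
        · rw [if_neg (fun hmem => by have := h2.1 hmem; tauto), if_pos hu, if_pos (h3 hu)]
          omega
        · by_cases hα : ∀ j < t, mtwV m q j ≠ α
          · rw [if_pos (h2.2 ⟨hα, Or.inr hu⟩), if_neg hu, if_pos hα]
            omega
          · rw [if_neg (fun hmem => hα (h2.1 hmem).1), if_neg hu, if_neg hα]
            omega
  have hk := key α
  rw [Nat.count_eq_card_filter_range (fun β => ∀ j < t, mtwV m q j ≠ β),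
    Nat.count_eq_card_filter_range (fun β => ∀ j < t, mtwV m q j ≠ β),
    ← Finset.card_filter_add_card_filter_not (s := (Finset.range α).filter _)
      (fun β => α ≤ β + m), Finset.filter_filter, Finset.filter_filter] at hk
  have e1 : (Finset.range α).filter (fun β => (∀ j < t, mtwV m q j ≠ β) ∧ ¬ α ≤ β + m)
      = (Finset.range (α - m)).filter (fun β => ∀ j < t, mtwV m q j ≠ β) := by
    ext β
    simp only [Finset.mem_filter, Finset.mem_range]
    constructor
    · rintro ⟨h1, h2, h3⟩
      exact ⟨by omega, h2⟩
    · rintro ⟨h1, h2⟩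
      exact ⟨by omega, h2, by omega⟩
  rw [e1] at hk
  simp only [and_comm (a := α ≤ _)]
  omega

end Values

/-! ### The Gorsky–Mazin–Vazirani algorithm inverts the second algorithm -/

section Inverse

variable {q : ℕ → ℕ} {e : ℕ ≃ ℕ}

/-- If `α - m` is used before time `i` and no number below `α` is used exactly at time `i`, then the
number of elements of `S_i` below `α` is the number of `β` in the open window `(α - m, α)` that are
placed to the right of position `i`. -/
theorem count_mtwSet_eq_card (hm : 0 < m) (hV : ∀ t, mtwV m q t ∈ mtwSet m q t)
    (he : ∀ i, e i = mtwV m q i) {i α : ℕ} (h1 : ∀ β < α, e.symm β ≠ i)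
    (h2 : ∀ β, β + m = α → e.symm β < i) :
    Nat.count (fun a => a ∈ mtwSet m q i) α
      = (Finset.univ.filter fun β : Fin α => α < (β : ℕ) + m ∧ i < e.symm β).card := by
  classical
  rw [count_mtwSet hm hV, Finset.card_filter, Finset.card_filter,
    Fin.sum_univ_eq_sum_range (fun β => if α < β + m ∧ i < e.symm β then 1 else 0) α]
  refine Finset.sum_congr rfl fun β hβ => if_congr ?_ rfl rfl
  have hu : (∀ j < i, mtwV m q j ≠ β) ↔ i ≤ e.symm β := by
    constructor
    · intro h
      by_contra hlt
      exact h _ (not_le.1 hlt) (by rw [← he, Equiv.apply_symm_apply])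
    · rintro h j hj rfl
      rw [← he, Equiv.symm_apply_apply] at h
      omega
  rw [hu]
  have h1' := h1 β (Finset.mem_range.1 hβ)
  have h2' := h2 β
  constructor
  · rintro ⟨h3, h4⟩
    refine ⟨lt_of_le_of_ne h3 fun h => ?_, lt_of_le_of_ne h4 h1'.symm⟩
    have := h2' h.symm
    omega
  · rintro ⟨h3, h4⟩
    exact ⟨h3.le, h4.le⟩

theorem symm_lt_symm_add (hm : 0 < m) (hV : ∀ t, mtwV m q t ∈ mtwSet m q t)
    (he : ∀ i, e i = mtwV m q i) (β : ℕ) : e.symm β < e.symm (β + m) := by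
  have h0 : mtwV m q (e.symm (β + m)) = β + m := by rw [← he, Equiv.apply_symm_apply]
  obtain ⟨j, hj, h⟩ := exists_lt_mtwV_add_eq hm hV (t := e.symm (β + m)) (by omega)
  have : e j = β := by rw [he]; omega
  rwa [← this, Equiv.symm_apply_apply, this]

/-- The value `q i` counts the positions right of `i` whose numbers lie in the window of length `m`
below `e i`. -/
theorem card_window (hm : 0 < m) (hV : ∀ t, mtwV m q t ∈ mtwSet m q t)
    (hc : ∀ t, Nat.count (fun a => a ∈ mtwSet m q t) (mtwV m q t) = q t)
    (he : ∀ i, e i = mtwV m q i) (α : ℕ) :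
    q (e.symm α)
      = (Finset.univ.filter fun β : Fin α => α < (β : ℕ) + m ∧ e.symm α < e.symm β).card := by
  rw [← count_mtwSet_eq_card hm hV he (fun β hβ => e.symm.injective.ne hβ.ne)
    (fun β hβ => hβ ▸ symm_lt_symm_add hm hV he β), ← hc (e.symm α)]
  congr 1
  rw [← he, Equiv.apply_symm_apply]

/-- Position `V⁻¹(α)` is the leftmost one allowed for `α`: at any earlier position `i` that
satisfies the conditions, `α` belongs to `S_i` and has index `q i` there, so that `V(i) = α`. -/
theorem isLeast_gmvAllowed (hm : 0 < m) (hV : ∀ t, mtwV m q t ∈ mtwSet m q t)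
    (hc : ∀ t, Nat.count (fun a => a ∈ mtwSet m q t) (mtwV m q t) = q t)
    (he : ∀ i, e i = mtwV m q i) (α : ℕ) :
    IsLeast (gmvAllowed m q α fun β : Fin α => e.symm β) (e.symm α) := by
  refine ⟨⟨fun β => e.symm.injective.ne β.2.ne, fun β hβ => ?_, card_window hm hV hc he α⟩, ?_⟩
  · have := symm_lt_symm_add hm hV he β
    rwa [hβ] at this
  · rintro i ⟨h1, h2, h3⟩
    by_contra hlt
    push Not at hlt
    have hmem : α ∈ mtwSet m q i := by
      refine (mem_mtwSet_iff hm hV i α).2 ⟨fun j hj h => ?_, ?_⟩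
      · rw [← h, ← he, Equiv.symm_apply_apply] at hlt
        omega
      · rcases lt_or_ge α m with h | h
        · exact Or.inl h
        · refine Or.inr ⟨e.symm (α - m), h2 ⟨α - m, by omega⟩ (by simp only; omega), ?_⟩
          rw [← he, Equiv.apply_symm_apply]
          omega
    have hcount := count_mtwSet_eq_card hm hV he (i := i) (α := α) (fun β hβ => h1 ⟨β, hβ⟩)
      (fun β hβ => h2 ⟨β, by omega⟩ hβ)
    rw [← h3] at hcount
    have hVi : mtwV m q i = α := by
      unfold mtwV
      rw [← hcount]
      exact Nat.nth_count hmem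
    rw [← hVi, ← he, Equiv.symm_apply_apply] at hlt
    exact lt_irrefl _ hlt

theorem gmvPos_eq_symm (hm : 0 < m) (hV : ∀ t, mtwV m q t ∈ mtwSet m q t)
    (hc : ∀ t, Nat.count (fun a => a ∈ mtwSet m q t) (mtwV m q t) = q t)
    (he : ∀ i, e i = mtwV m q i) (α : ℕ) : gmvPos m q α = e.symm α := by
  induction α using Nat.strong_induction_on with
  | _ α ih =>
    rw [gmvPos]
    have : (fun β : Fin α => gmvPos m q (β : ℕ)) = fun β : Fin α => e.symm β :=
      funext fun β => ih β β.2
    rw [this]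
    exact (isLeast_gmvAllowed hm hV hc he α).csInf_eq

theorem gmvU_eq (hm : 0 < m) (hV : ∀ t, mtwV m q t ∈ mtwSet m q t)
    (hc : ∀ t, Nat.count (fun a => a ∈ mtwSet m q t) (mtwV m q t) = q t)
    (he : ∀ i, e i = mtwV m q i) (i : ℕ) : gmvU m q i = (e i : ℕ∞) := by
  have : {a : ℕ∞ | ∃ α : ℕ, gmvPos m q α = i ∧ a = (α : ℕ∞)} = {(e i : ℕ∞)} := by
    ext a
    simp only [Set.mem_ofPred_eq, Set.mem_singleton_iff, gmvPos_eq_symm hm hV hc he]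
    constructor
    · rintro ⟨α, h, rfl⟩
      rw [← h, Equiv.apply_symm_apply]
    · rintro rfl
      exact ⟨e i, by simp, rfl⟩
  rw [gmvU, this, csInf_singleton]

end Inverse

/-! ### The affine permutation with the same values far to the right -/

section Extension

variable {n N : ℕ} {e : ℕ ≃ ℕ}

theorem add_mul_period (hper : ∀ i, N < i → e (i + n) = e i + n) {i : ℕ} (hi : N < i) (k : ℕ) :
    e (i + k * n) = e i + k * n := by
  induction k with
  | zero => simp
  | succ k ih =>
    rw [add_mul, one_mul, ← add_assoc, hper _ (by omega), ih, add_assoc]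

/-- The extension to `ℤ` of the values of `e` far to the right, where they are affine periodic with
period `n`: the argument is translated by a multiple of `n` beyond `N`, so that it is positive and
`toNat` does not truncate. -/
def affineExt (e : ℕ ≃ ℕ) (n N : ℕ) (x : ℤ) : ℤ :=
  (e (x + ((N + 1 + x.natAbs : ℕ) : ℤ) * n).toNat : ℤ) - ((N + 1 + x.natAbs : ℕ) : ℤ) * n

theorem lt_add_mul [NeZero n] (N : ℕ) (x : ℤ) : (N : ℤ) < x + ((N + 1 + x.natAbs : ℕ) : ℤ) * n := by
  have h1 : (1 : ℤ) ≤ n := by exact_mod_cast NeZero.one_le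
  have h2 : ((N + 1 + x.natAbs : ℕ) : ℤ) * 1 ≤ ((N + 1 + x.natAbs : ℕ) : ℤ) * n :=
    mul_le_mul_of_nonneg_left h1 (by positivity)
  push_cast at h2 ⊢
  have := neg_abs_le x
  linarith

theorem affineExt_eq [NeZero n] (hper : ∀ i, N < i → e (i + n) = e i + n) {x : ℤ} {k : ℕ}
    (h : (N : ℤ) < x + (k : ℤ) * n) :
    affineExt e n N x = (e (x + (k : ℤ) * n).toNat : ℤ) - (k : ℤ) * n := by
  unfold affineExt
  have hK := lt_add_mul (n := n) N x
  generalize N + 1 + x.natAbs = K at *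
  have e1 := add_mul_period hper (i := (x + (k : ℤ) * n).toNat) (by omega) K
  have e2 := add_mul_period hper (i := (x + (K : ℤ) * n).toNat) (by omega) k
  have e3 : (x + (k : ℤ) * n).toNat + K * n = (x + (K : ℤ) * n).toNat + k * n := by
    zify
    rw [Int.toNat_of_nonneg (by omega), Int.toNat_of_nonneg (by omega)]
    ring
  rw [e3, e2] at e1
  have e4 := congrArg (Nat.cast (R := ℤ)) e1
  push_cast at e4
  linarith

theorem affineExt_natCast [NeZero n] (hper : ∀ i, N < i → e (i + n) = e i + n) {i : ℕ}
    (h : N < i) : affineExt e n N i = e i := by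
  rw [affineExt_eq hper (k := 0) (by simpa using h)]
  simp

theorem affineExt_add_period [NeZero n] (hper : ∀ i, N < i → e (i + n) = e i + n) (x : ℤ) :
    affineExt e n N (x + n) = affineExt e n N x + n := by
  have hK := lt_add_mul (n := n) N x
  generalize N + 1 + x.natAbs = K at *
  have e1 : x + n + (K : ℤ) * n = x + ((K + 1 : ℕ) : ℤ) * n := by push_cast; ring
  have hn : (0 : ℤ) ≤ n := by positivity
  have e2 : x + ((K + 1 : ℕ) : ℤ) * n = x + K * n + n := by push_cast; ring
  rw [affineExt_eq hper (k := K) (by linarith), affineExt_eq hper (x := x) (k := K + 1)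
    (by linarith), e1]
  push_cast
  ring

/-- Two arguments can be translated beyond `N` by a common multiple of the period. -/
theorem exists_common_shift [NeZero n] (N : ℕ) (x y : ℤ) :
    ∃ k : ℕ, (N : ℤ) < x + (k : ℤ) * n ∧ (N : ℤ) < y + (k : ℤ) * n := by
  have h1 := lt_add_mul (n := n) N x
  have h2 := lt_add_mul (n := n) N y
  have hn : (0 : ℤ) ≤ n := by positivity
  refine ⟨N + 1 + (x.natAbs + y.natAbs), ?_, ?_⟩
  · have := mul_nonneg (Int.natCast_nonneg y.natAbs) hn
    push_cast at *
    linarith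
  · have := mul_nonneg (Int.natCast_nonneg x.natAbs) hn
    push_cast at *
    linarith

theorem bijective_affineExt [NeZero n] (hper : ∀ i, N < i → e (i + n) = e i + n) :
    Function.Bijective (affineExt e n N) := by
  constructor
  · intro x y hxy
    obtain ⟨k, hx, hy⟩ := exists_common_shift (n := n) N x y
    rw [affineExt_eq hper hx, affineExt_eq hper hy] at hxy
    have h1 : (x + (k : ℤ) * n).toNat = (y + (k : ℤ) * n).toNat :=
      e.injective (by exact_mod_cast sub_left_injective hxy)
    omega
  · intro y
    -- a translate of `y` larger than all values at the positions up to `N`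
    set C := ∑ i ∈ Finset.range (N + 1), e i with hC
    have hk := lt_add_mul (n := n) C y
    generalize C + 1 + y.natAbs = k at *
    set i := e.symm (y + (k : ℤ) * n).toNat with hi
    have hei : e i = (y + (k : ℤ) * n).toNat := by rw [hi, Equiv.apply_symm_apply]
    have hNi : N < i := by
      by_contra hle
      have : e i ≤ C := Finset.single_le_sum (f := fun i => e i) (fun _ _ => Nat.zero_le _)
        (Finset.mem_range.2 (by omega))
      omega
    refine ⟨(i : ℤ) - k * n, ?_⟩
    have h1 : (i : ℤ) - k * n + k * n = i := by ring
    rw [affineExt_eq hper (k := k) (by rw [h1]; exact_mod_cast hNi), h1, Int.toNat_natCast, hei,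
      Int.toNat_of_nonneg (by omega)]
    ring

theorem exists_displacement_bound [NeZero n] (hper : ∀ i, N < i → e (i + n) = e i + n) :
    ∃ D : ℕ, ∀ i, e i ≤ i + D ∧ i ≤ e i + D := by
  refine ⟨∑ i ∈ Finset.range (N + 1 + n), (e i + i), fun i => ?_⟩
  set D := ∑ i ∈ Finset.range (N + 1 + n), (e i + i)
  have hn : 0 < n := NeZero.pos n
  induction i using Nat.strong_induction_on with
  | _ i ih =>
    rcases lt_or_ge i (N + 1 + n) with h | h
    · have : e i + i ≤ D := Finset.single_le_sum (f := fun i => e i + i)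
        (fun _ _ => Nat.zero_le _) (Finset.mem_range.2 h)
      omega
    · have h1 := ih (i - n) (by omega)
      have h2 := hper (i - n) (by omega)
      rw [Nat.sub_add_cancel (by omega)] at h2
      omega

/-- A bijection of `ℕ` with bounded displacement has no drift: the sum of its first `M` values
differs from `0 + 1 + ⋯ + (M - 1)` by a bounded amount. -/
theorem abs_sum_sub_le {D : ℕ} (hD : ∀ i, e i ≤ i + D ∧ i ≤ e i + D) (M : ℕ) :
    |∑ i ∈ Finset.range M, ((e i : ℤ) - i)| ≤ 2 * D * D := by
  rcases le_or_gt M D with hM | hM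
  · refine (Finset.abs_sum_le_sum_abs _ _).trans ?_
    have h1 : ∑ i ∈ Finset.range M, |(e i : ℤ) - i| ≤ ∑ i ∈ Finset.range M, (D : ℤ) :=
      Finset.sum_le_sum fun i _ => by
        have := hD i
        rw [abs_le]
        omega
    rw [Finset.sum_const, Finset.card_range, nsmul_eq_mul] at h1
    have h2 : (M : ℤ) * D ≤ D * D :=
      mul_le_mul_of_nonneg_right (by exact_mod_cast hM) (by positivity)
    have h3 : (0 : ℤ) ≤ D * D := by positivity
    linarith
  -- the image of `[0, M)` consists of `[0, M - D)` and `D` numbers from `[M - D, M + D)`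
  obtain ⟨K, rfl⟩ := Nat.exists_eq_add_of_le' hM.le
  have hsub : Finset.range K ⊆ (Finset.range (K + D)).image e := by
    intro a ha
    refine Finset.mem_image.2 ⟨e.symm a, Finset.mem_range.2 ?_, by simp⟩
    have := hD (e.symm a)
    rw [Equiv.apply_symm_apply] at this
    have := Finset.mem_range.1 ha
    omega
  set R := (Finset.range (K + D)).image e \ Finset.range K with hR
  have hcard : R.card = D := by
    rw [hR, Finset.card_sdiff_of_subset hsub, Finset.card_image_of_injective _ e.injective,
      Finset.card_range, Finset.card_range]
    omega
  have hsum1 : ∑ i ∈ Finset.range (K + D), (e i : ℤ)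
      = ∑ a ∈ Finset.range K, (a : ℤ) + ∑ a ∈ R, (a : ℤ) := by
    rw [hR, add_comm (∑ a ∈ Finset.range K, (a : ℤ)), Finset.sum_sdiff hsub,
      Finset.sum_image (fun _ _ _ _ h => e.injective h)]
  have hlow : ∀ a ∈ R, (K : ℤ) ≤ a := by
    intro a ha
    have := (Finset.mem_sdiff.1 ha).2
    rw [Finset.mem_range] at this
    exact_mod_cast not_lt.1 this
  have hup : ∀ a ∈ R, (a : ℤ) ≤ K + 2 * D := by
    intro a ha
    obtain ⟨i, hi, rfl⟩ := Finset.mem_image.1 (Finset.mem_sdiff.1 ha).1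
    have := hD i
    have := Finset.mem_range.1 hi
    omega
  have h1 := Finset.card_nsmul_le_sum R (fun a => (a : ℤ)) _ hlow
  have h2 := Finset.sum_le_card_nsmul R (fun a => (a : ℤ)) _ hup
  have h3 := Finset.sum_range_add (fun i => (i : ℤ)) K D
  have h4 : ∀ i ∈ Finset.range D, ((K : ℤ) ≤ ((K + i : ℕ) : ℤ)) := fun i _ => by push_cast; omega
  have h5 : ∀ i ∈ Finset.range D, (((K + i : ℕ) : ℤ) ≤ (K : ℤ) + 2 * D) := fun i hi => by
    have := Finset.mem_range.1 hi
    push_cast; omega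
  have h6 := Finset.card_nsmul_le_sum _ _ _ h4
  have h7 := Finset.sum_le_card_nsmul _ _ _ h5
  rw [hcard, nsmul_eq_mul] at h1 h2
  rw [Finset.card_range, nsmul_eq_mul] at h6 h7
  rw [Finset.sum_sub_distrib, hsum1, h3, abs_le]
  constructor <;> nlinarith

theorem sum_affineExt [NeZero n] (hper : ∀ i, N < i → e (i + n) = e i + n) :
    ∑ k ∈ Finset.range n, affineExt e n N k = ∑ k ∈ Finset.range n, (k : ℤ) := by
  obtain ⟨D, hD⟩ := exists_displacement_bound hper
  set c := ∑ k ∈ Finset.range n, (affineExt e n N k - k) with hc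
  have hn : 1 ≤ n := NeZero.one_le
  have hblock : ∀ k, ∑ i ∈ Finset.range ((N + 1 + k) * n), ((e i : ℤ) - i)
      = ∑ i ∈ Finset.range ((N + 1) * n), ((e i : ℤ) - i) + k * c := by
    intro k
    induction k with
    | zero => simp
    | succ k ih =>
      have h1 : (N + 1 + (k + 1)) * n = (N + 1 + k) * n + n := by ring
      rw [h1, Finset.sum_range_add, ih, hc]
      have h2 : ∑ x ∈ Finset.range n, ((e ((N + 1 + k) * n + x) : ℤ) - ((N + 1 + k) * n + x : ℕ))
          = c := by
        refine Finset.sum_congr rfl fun x _ => ?_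
        have h3 : N < (N + 1 + k) * n := by nlinarith
        have h4 : (x : ℤ) + ((N + 1 + k : ℕ) : ℤ) * n = (((N + 1 + k) * n + x : ℕ) : ℤ) := by
          push_cast; ring
        rw [affineExt_eq hper (k := N + 1 + k) (by rw [h4]; exact_mod_cast (by omega)), h4,
          Int.toNat_natCast]
        push_cast
        ring
      rw [h2, ← hc]
      push_cast
      ring
  -- the partial sums are bounded, so the increment `c` of each period vanishes
  have hc0 : c = 0 := by
    by_contra hne
    have h1 := abs_sum_sub_le hD ((N + 1) * n)
    have h2 := abs_sum_sub_le hD ((N + 1 + (4 * D * D + 1)) * n)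
    rw [hblock] at h2
    have h3 : |((4 * D * D + 1 : ℕ) : ℤ) * c| ≤ 4 * D * D := by
      rw [abs_le] at h1 h2 ⊢
      constructor <;> linarith
    rw [abs_mul, Nat.abs_cast] at h3
    have h4 : 1 ≤ |c| := Int.one_le_abs hne
    have h5 := mul_le_mul_of_nonneg_left h4 (Int.natCast_nonneg (4 * D * D + 1))
    push_cast at h3 h5
    linarith
  rw [hc, Finset.sum_sub_distrib] at hc0
  linarith

/-- The affine permutation that agrees with `e` far to the right. -/
noncomputable def affineExtPerm [NeZero n] (hper : ∀ i, N < i → e (i + n) = e i + n) :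
    Equiv.Perm ℤ :=
  Equiv.ofBijective _ (bijective_affineExt hper)

theorem isRestrictedAffinePerm_affineExtPerm [NeZero n]
    (hper : ∀ i, N < i → e (i + n) = e i + n) (hres : ∀ β, e.symm β < e.symm (β + m)) :
    IsRestrictedAffinePerm m n (affineExtPerm hper) := by
  refine ⟨⟨affineExt_add_period hper, sum_affineExt hper⟩, fun x => ?_⟩
  set i := (affineExtPerm hper).symm x with hi
  set j := (affineExtPerm hper).symm (x + m) with hj
  have hxi : affineExt e n N i = x := (affineExtPerm hper).apply_symm_apply x
  have hxj : affineExt e n N j = x + m := (affineExtPerm hper).apply_symm_apply (x + m)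
  obtain ⟨k, h1, h2⟩ := exists_common_shift (n := n) N i j
  rw [affineExt_eq hper h1] at hxi
  rw [affineExt_eq hper h2] at hxj
  have h3 : e (j + (k : ℤ) * n).toNat = e (i + (k : ℤ) * n).toNat + m := by omega
  have h4 := hres (e (i + (k : ℤ) * n).toNat)
  rw [← h3, Equiv.symm_apply_apply, Equiv.symm_apply_apply] at h4
  omega

theorem pakStanley_affineExtPerm [NeZero n] (hper : ∀ i, N < i → e (i + n) = e i + n) {i k : ℕ}
    (hk : N < i + k * n) :
    pakStanley m (affineExtPerm hper) i
      = (Finset.univ.filter fun β : Fin (e (i + k * n)) =>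
          e (i + k * n) < (β : ℕ) + m ∧ i + k * n < e.symm β).card := by
  have hval : ∀ j : ℤ, (i : ℤ) ≤ j → affineExtPerm hper j
      = (e (j + (k : ℤ) * n).toNat : ℤ) - (k : ℤ) * n := fun j hj =>
    affineExt_eq hper (by
      have : (N : ℤ) < i + (k : ℤ) * n := by exact_mod_cast hk
      linarith)
  have hi' : ((i : ℤ) + (k : ℤ) * n).toNat = i + k * n := by
    rw [← Nat.cast_mul, ← Nat.cast_add, Int.toNat_natCast]
  have hi := hval i le_rfl
  rw [hi'] at hi
  have hkn : (0 : ℤ) ≤ (k : ℤ) * n := by positivity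
  have hcast : ((k * n : ℕ) : ℤ) = (k : ℤ) * n := by push_cast; ring
  rw [← Set.ncard_coe_finset]
  unfold pakStanley
  rw [hi]
  refine Set.ncard_congr (fun j hj => ⟨e (j + (k : ℤ) * n).toNat, ?_⟩) ?_ ?_ ?_
  · obtain ⟨h1, h2, h3⟩ := hj
    rw [hval j h1.le] at h2
    omega
  · intro j hj
    obtain ⟨h1, h2, h3⟩ := hj
    rw [hval j h1.le] at h2 h3
    simp only [Finset.coe_filter, Finset.mem_univ, true_and, Set.mem_ofPred_eq,
      Equiv.symm_apply_apply]
    omega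
  · intro j j' hj hj' h
    have h1 := hj.1
    have h2 := hj'.1
    have h3 := e.injective (Fin.mk.inj_iff.1 h)
    omega
  · rintro ⟨β, hβ⟩ h
    simp only [Finset.coe_filter, Finset.mem_univ, true_and, Set.mem_ofPred_eq] at h
    have h1 : ((e.symm β : ℤ) - k * n + k * n).toNat = e.symm β := by
      rw [sub_add_cancel, Int.toNat_natCast]
    have h2 : (i : ℤ) < (e.symm β : ℤ) - k * n := by omega
    refine ⟨(e.symm β : ℤ) - k * n, ⟨h2, ?_⟩, ?_⟩
    · rw [hval _ h2.le, h1, Equiv.apply_symm_apply]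
      omega
    · simp only [h1, Equiv.apply_symm_apply]

end Extension

/-! ### Eventual periodicity -/

theorem iterate_eq_of_isFixedPt {n : ℕ} {p : Fin n → Fin m} {x : Fin m → ℝ} {a k : ℕ}
    (ha : wordAct p ((wordAct p)^[a] x) = (wordAct p)^[a] x) (hk : a ≤ k) :
    (wordAct p)^[k] x = (wordAct p)^[a] x := by
  obtain ⟨j, rfl⟩ := Nat.exists_eq_add_of_le' hk
  rw [Function.iterate_add_apply]
  exact Function.iterate_fixed ha j

theorem mtwV_add_period {n : ℕ} [NeZero m] [NeZero n] {p : Fin n → Fin m} {a : ℕ}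
    (ha : wordAct p ((wordAct p)^[a] (fundamentalCentroid m))
      = (wordAct p)^[a] (fundamentalCentroid m)) {t : ℕ} (ht : a * n < t) :
    mtwV m (periodicExt p) (t + n) = mtwV m (periodicExt p) t + n := by
  obtain ⟨r, rfl⟩ := Nat.exists_eq_add_of_le ht.le
  have h1 := mtwV_eq_run (periodicLetters p) (a * n + r + n)
  have h2 := mtwV_eq_run (periodicLetters p) (a * n + r)
  rw [periodicLetters_add, add_right_comm, ← Nat.succ_mul, run_add_period,
    Function.iterate_succ_apply', ha, Nat.succ_mul, add_right_comm] at h1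
  rw [run_add_period] at h2
  have h3 : (mtwV m (fun t => (periodicLetters p t : ℕ)) (a * n + r + n) : ℝ)
      = ((mtwV m (fun t => (periodicLetters p t : ℕ)) (a * n + r) + n : ℕ) : ℝ) := by
    rw [h1]
    push_cast
    rw [h2]
    push_cast
    ring
  exact_mod_cast h3

theorem exists_forall_mem_mtwSet_lt {n : ℕ} [NeZero m] [NeZero n] {p : Fin n → Fin m} {a : ℕ}
    (ha : wordAct p ((wordAct p)^[a] (fundamentalCentroid m))
      = (wordAct p)^[a] (fundamentalCentroid m)) (α : ℕ) :
    ∃ t, ∀ s ∈ mtwSet m (periodicExt p) t, α < s := by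
  set x := (wordAct p)^[a] (fundamentalCentroid m) with hx
  obtain ⟨K, hK⟩ := exists_nat_ge (∑ i, |x i| + α + 1)
  refine ⟨(a + K) * n, fun b hb => ?_⟩
  obtain ⟨s, -, hS, hs⟩ := exists_enum_mtwSet (periodicLetters p) ((a + K) * n)
  have hb' : b ∈ Finset.univ.image s := hS ▸ hb
  obtain ⟨j, -, rfl⟩ := Finset.mem_image.1 hb'
  have h1 := hs j
  rw [← add_zero ((a + K) * n), run_add_period, iterate_eq_of_isFixedPt ha (Nat.le_add_right a K),
    ← hx, add_zero] at h1
  have h2 : |x j| ≤ ∑ i, |x i| :=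
    Finset.single_le_sum (f := fun i => |x i|) (fun _ _ => abs_nonneg _) (Finset.mem_univ j)
  have h3 := neg_abs_le (x j)
  have hm : (1 : ℝ) ≤ m := by exact_mod_cast NeZero.one_le
  have h4 : K ≤ (a + K) * n := (Nat.le_add_left K a).trans (Nat.le_mul_of_pos_right _ (NeZero.pos n))
  have h5 : (K : ℝ) ≤ ((a + K) * n : ℕ) := by exact_mod_cast h4
  have h6 : (α : ℝ) < s j := by
    simp only [run] at h1
    linarith
  exact_mod_cast h6

theorem mainTheorem6 (m n : ℕ) [NeZero m] [NeZero n] (hmn : Nat.Coprime m n)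
    (p : Fin n → Fin m) (hp : IsParkingFunction p) :
    -- the centroid of the fundamental alcove reaches the fixed point
    (∃ xp ∈ weylChamber m, wordAct p xp = xp ∧
      (∀ y ∈ weylChamber m, wordAct p y = y → y = xp) ∧
      (∃ A, IsAlcove m A ∧ IsAlcoveCentroid A xp) ∧
      (∃! x₀, IsAlcoveCentroid (fundamentalAlcove m) x₀) ∧
      ∀ x₀, IsAlcoveCentroid (fundamentalAlcove m) x₀ →
        ∃ K : ℕ, ∀ k ≥ K, (wordAct p)^[k] x₀ = xp) ∧
    -- the Gorsky–Mazin–Vazirani algorithm: every step can be carried out, no gaps are left,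
    -- the output becomes affine periodic, and its periodic part is an inverse image of `p`
    (∀ α : ℕ, (gmvAllowed m (periodicExt p) α
      fun β : Fin α => gmvPos m (periodicExt p) (β : ℕ)).Nonempty) ∧
    (∀ i : ℕ, gmvU m (periodicExt p) i ≠ ⊤) ∧
    (∃ N : ℕ,
      (∀ i : ℕ, N < i →
        gmvU m (periodicExt p) (i + n) = gmvU m (periodicExt p) i + (n : ℕ∞)) ∧
      ∃ u : Equiv.Perm ℤ, IsRestrictedAffinePerm m n u ∧
        (∀ i : ℕ, N < i → u (i : ℤ) = ((gmvU m (periodicExt p) i).toNat : ℤ)) ∧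
        ∀ i : Fin n, pakStanley m u ((i : ℕ) : ℤ) = (p i : ℕ)) ∧
    -- the second algorithm becomes affine periodic
    (∃ N : ℕ, ∀ i : ℕ, N < i →
      mtwV m (periodicExt p) (i + n) = mtwV m (periodicExt p) i + n) := by
  have hx₀ := isLatticePoint_fundamentalCentroid m
  obtain ⟨a, ha⟩ := hp.exists_isFixedPt_iterate hmn hx₀
  have hxp := hx₀.wordAct_iterate p a
  have hm : 0 < m := NeZero.pos m
  have hV : ∀ t, mtwV m (periodicExt p) t ∈ mtwSet m (periodicExt p) t :=
    mtwV_mem (periodicLetters p)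
  have hc : ∀ t, Nat.count (fun b => b ∈ mtwSet m (periodicExt p) t) (mtwV m (periodicExt p) t)
      = periodicExt p t := count_mtwV (periodicLetters p)
  have hbij : Function.Bijective (mtwV m (periodicExt p)) :=
    ⟨injective_mtwV hm hV, surjective_mtwV hm hV (exists_forall_mem_mtwSet_lt ha)⟩
  set e : ℕ ≃ ℕ := Equiv.ofBijective _ hbij with he_def
  have he : ∀ i, e i = mtwV m (periodicExt p) i := fun _ => rfl
  have hper : ∀ i, a * n < i → e (i + n) = e i + n := fun i hi => mtwV_add_period ha hi
  have hU := gmvU_eq hm hV hc he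
  refine ⟨⟨_, ⟨hxp.sum_eq, hxp.mono⟩, ha, fun y hy hpy => ?_, hxp.exists_isAlcoveCentroid,
    ⟨_, isAlcoveCentroid_fundamentalCentroid m, fun _ => eq_fundamentalCentroid⟩,
    fun x₀ h₀ => ⟨a, fun k hk => ?_⟩⟩, fun α => ?_, fun i => ?_, ⟨a * n, fun i hi => ?_,
    affineExtPerm hper, isRestrictedAffinePerm_affineExtPerm hper (symm_lt_symm_add hm hV he),
    fun i hi => ?_, fun i => ?_⟩, ⟨a * n, fun i hi => hper i hi⟩⟩
  · exact (isLatticePoint_of_wordAct_eq hmn hy hpy).eq_of_wordAct_eq hmn hxp hpy ha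
  · rw [eq_fundamentalCentroid h₀]
    exact iterate_eq_of_isFixedPt ha hk
  · simp only [gmvPos_eq_symm hm hV hc he]
    exact ⟨_, (isLeast_gmvAllowed hm hV hc he α).1⟩
  · rw [hU]
    exact ENat.natCast_ne_top _
  · rw [hU, hU, hper i hi]
    push_cast
    rfl
  · rw [hU, ENat.toNat_natCast]
    exact affineExt_natCast hper hi
  · have hk : a * n < i + (a + 1) * n := by
      have := NeZero.pos n
      nlinarith
    have hw := card_window hm hV hc he (e (i + (a + 1) * n))
    rw [Equiv.symm_apply_apply] at hw
    rw [pakStanley_affineExtPerm hper hk, ← hw]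
    change (periodicLetters p (i + (a + 1) * n) : ℕ) = p i
    rw [periodicLetters_add_mul, periodicLetters_val]
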